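/- Let $V:\mathbb R\to\mathbb R$ be continuous with $\lim_{|x|\to\infty}\frac{V(x)}{\log|x|}=+\infty$, and let $\gamma\in\mathbb R$. For a finite nonnegative Borel measure $\mu\neq0$ on $\mathbb R$ put \[ \mathcal E_V(\mu)=2\int_{\mathbb R}V\,d\mu-\iint_{\mathbb R\times\mathbb R}\log|x-y|\,d\mu(x)\,d\mu(y) =\iint_{\mathbb R\times\mathbb R}\Big(\tfrac{V(x)+V(y)}{\mu(\mathbb R)}-\log|x-y|\Big)\,d\mu(x)\,d\mu(y)\in(-\infty,+\infty], \] the last expression being the definition. For $s>0$ let $\mu_s$ be the (unique) minimizer of $\mathcal E_V$ among the nonnegative Borel measures on $\mathbb R$ of total mass $s$. Let $V_{s,\gamma}(x)=\frac{V(s^\gamma x)}{s}$, and let $C_{V_{s,\gamma}}$ be the unique constant such that the probability measure $\nu$ minimizing $\mathcal E_{V_{s,\gamma}}$ satisfies \[ -\int_{\mathbb R}\log|x-t|\,d\nu(t)\ \ge\ C_{V_{s,\gamma}}-V_{s,\gamma}(x)\quad\text{for every }x\in\mathbb R,\text{ with equality }\nu\text{-a.e.} \] Define, for $x=(x_1,x_2)\in\mathbb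 R^2$, \[ u_s(x)=-\int_{\mathbb R}\log|x-(t,0)|\,d\mu_s(t)+\gamma s\log s-s\,C_{V_{s,\gamma}} . \] Then every $u_s$ is finite at every point of $\mathbb R^2$, and the following hold. (1) $u_s\ge u_{s'}$ in $\mathbb R^2$ whenever $0<s<s'$. (2) For every $M>0$ there is $R_0>0$ such that for every $R\ge R_0$ there is $a=a(R)>0$ such that, for all $s$ and all $\delta>0$ with $0<s-\delta<s\le M$, \[ u_{s-\delta}(x)-u_s(x)>a\,\delta\qquad\text{for all }x\in\partial B_R\text{ with }|x_2|>R/2, \] where $B_R\subset\mathbb R^2$ is the open disc of radius $R$ centred at the origin. -/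

import Mathlib

open MeasureTheory Filter Topology

noncomputable section

namespace LogGas

/-- The integral of an extended-real function: integral of the positive part minus integral of
the negative part. It is the usual integral whenever one of the two is finite; this is always so
below, where the integrands are bounded below and the measures finite (energies), or the measure
is compactly supported (potentials). -/
def eintegral {X : Type*} [MeasurableSpace X] (μ : Measure X) (f : X → EReal) : EReal :=
  ((∫⁻ x, (f x).toENNReal ∂μ : ENNReal) : EReal) -
    ((∫⁻ x, (-(f x)).toENNReal ∂μ : ENNReal) : EReal)

/-- The logarithmic energy of a finite measure `μ` on `ℝ` in the external potential `V`,
`2 ∫ V dμ - ∬ log |x - y| dμ(x) dμ(y)`,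
written as one double integral of `(V(x) + V(y)) / μ(ℝ) - log |x - y|` (equal to `+∞` on the
diagonal). For probability measures the integrand is `V(x) + V(y) - log |x - y|`. -/
def energy (V : ℝ → ℝ) (μ : Measure ℝ) : EReal :=
  eintegral (μ.prod μ) fun p =>
    (((V p.1 + V p.2) / μ.real Set.univ : ℝ) : EReal) - ENNReal.log (edist p.1 p.2)

/-- `μ` minimizes the energy among the nonnegative Borel measures on `ℝ` of total mass `s`. -/
def IsEnergyMinimizer (V : ℝ → ℝ) (s : ℝ) (μ : Measure ℝ) : Prop :=
  μ Set.univ = ENNReal.ofReal s ∧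
    ∀ ν : Measure ℝ, ν Set.univ = ENNReal.ofReal s → energy V μ ≤ energy V ν

/-- The minimizer of the energy among measures of total mass `s`. -/
def equilibriumMeasure (V : ℝ → ℝ) (s : ℝ) : Measure ℝ :=
  Classical.epsilon fun μ => IsEnergyMinimizer V s μ

/-- The logarithmic potential `x ↦ -∫ log |x - (t, 0)| dμ(t)` on `ℝ²` of a measure on the line
`ℝ = ℝ × {0}`. -/
def logPotential (μ : Measure ℝ) (x : EuclideanSpace ℝ (Fin 2)) : EReal :=
  eintegral μ fun t => -ENNReal.log (edist x (!₂[t, 0] : EuclideanSpace ℝ (Fin 2)))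

/-- `C` is the constant of the Euler-Lagrange conditions: `-∫ log |x - t| dμ(t) ≥ C - V(x)` for
every real `x`, with equality for `μ`-almost every `x`. -/
def IsEulerLagrangeConstant (V : ℝ → ℝ) (μ : Measure ℝ) (C : ℝ) : Prop :=
  (∀ x : ℝ, ((C - V x : ℝ) : EReal) ≤ logPotential μ !₂[x, 0]) ∧
    ∀ᵐ x ∂μ, logPotential μ !₂[x, 0] = ((C - V x : ℝ) : EReal)

/-- The constant `C_V` associated with the probability measure that minimizes the energy. -/
def equilibriumConstant (V : ℝ → ℝ) : ℝ :=
  Classical.epsilon fun C : ℝ => IsEulerLagrangeConstant V (equilibriumMeasure V 1) C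

/-- The rescaled potential `V_{s,γ}(x) = V(s^γ x) / s`. -/
def rescaledPotential (V : ℝ → ℝ) (γ s : ℝ) (x : ℝ) : ℝ :=
  V (s ^ γ * x) / s

/-- `u_s(x) = -∫ log |x - (t, 0)| dμ_s(t) + γ s log s - s C_{V_{s,γ}}` for `x ∈ ℝ²`, where `μ_s`
is the minimizer of mass `s`. The additive constant is the one for which `u_s ≥ -V` on the line,
with equality `μ_s`-almost everywhere. -/
def shiftedPotential (V : ℝ → ℝ) (γ s : ℝ) (x : EuclideanSpace ℝ (Fin 2)) : EReal :=
  logPotential (equilibriumMeasure V s) x +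
    ((γ * s * Real.log s - s * equilibriumConstant (rescaledPotential V γ s) : ℝ) : EReal)

end LogGas

end

/-!
# Monotonicity of shifted equilibrium potentials

The whole argument rests on the Euler–Lagrange conditions. For a minimizer `μ` of mass `s`, let
`P(z) = -∫ log |z - t| dμ(t)`. There is a constant `F` such that `P - F ≥ -V` on the line, with
equality `μ`-almost everywhere, `μ` has compact support, and `P` is finite and continuous on the
whole plane. Such a pair `(μ, F)` is an `IsEquilibriumPair`.

*Minimizers give equilibrium pairs.* After adding a constant the energy kernel is nonnegative and
continuous with values in `[0, ∞]`, and the energy dominates `∫ log (1 + |x|)`; so energy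
sublevel sets are compact by Prokhorov's theorem and minimizers exist
(`exists_isEnergyMinimizer`). The first variation shows that the kernel potential of `μ` is at
least a constant `η`-almost everywhere for every `η` of finite energy. Taking `η = μ` gives
equality `μ`-almost everywhere (`ae_kernelPotential_eq_div`); taking Lebesgue measure on
shrinking intervals gives the inequality at every point (`div_le_kernelPotential`). Lower
semicontinuity turns almost everywhere equality into equality on the support, so `P` is
continuous on the support, hence on the plane by the Evans–Vasilesco theorem
(`hasContinuousPotential_of_continuousOn`).

*Comparison.* The maximum principle for continuous functions satisfying a sub-mean value
inequality yields the domination principle (`HasContinuousPotential.le_of_le_on`): if a potential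
lies below another one, of no larger mass, on a compact set carrying its measure, it does so
everywhere. Applied to equilibrium pairs of masses `s ≤ s'`, it gives `P' - F' ≤ P - F`
(`IsEquilibriumPair.sub_le_sub`). For equal masses the inequality holds in both directions, and
comparing averages over a large circle gives `F = F'`. Rescaling an equilibrium pair for
`V_{s,γ}` of mass `1` gives one for `V` of mass `s` with constant `s C - γ s log s`; by uniqueness
of the constant, `u_s = P - F` (`shiftedPotential_eq`). Thus finiteness and monotonicity follow.

*Strict monotonicity.* By monotonicity the contact sets `{P - F = -V}` increase with `s`, so for
`s ≤ M` all the measures live in one disc of radius `R₁`. The difference `u_{s-δ} - u_s` is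
nonnegative, superharmonic off this disc, and grows like `δ log |z|`; by the maximum principle it
is at least `(δ / 2) log (|z| / R₁)` off the disc (`HasContinuousPotential.mul_log_le_sub`).
-/

namespace LogGas

section

variable {μ μ₁ μ₂ : Measure ℝ} {R R₁ R₂ : ℝ}

/-! ### The maximum principle and circle averages of logarithmic potentials -/

/-- Maximum principle. At a point of the maximum set with largest real part the sub-mean value
property would force the maximum to be attained further to the right. -/
theorem nonpos_of_le_circleAverage {f : ℂ → ℝ} {A : Set ℂ} (hf : Continuous f)
    (hA : ∀ z ∈ A, f z ≤ 0) (hinf : ∀ᶠ z in cocompact ℂ, f z ≤ 0)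
    (hsub : ∀ z, z ∉ A → ∃ r > 0, f z ≤ Real.circleAverage f z r) (z : ℂ) : f z ≤ 0 := by
  by_contra! hz
  obtain ⟨z₁, hz₁⟩ := hf.exists_forall_ge' z (hinf.mono fun w hw => hw.trans hz.le)
  have hm : 0 < f z₁ := hz.trans_le (hz₁ z)
  have hK : IsCompact {w | f w = f z₁} := by
    obtain ⟨T, hT, hTs⟩ := mem_cocompact.1 hinf
    refine hT.of_isClosed_subset (isClosed_eq hf continuous_const) fun w hw => ?_
    by_contra hwT
    have h1 : f w ≤ 0 := hTs hwT
    have h2 : f w = f z₁ := hw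
    linarith
  obtain ⟨z₂, hz₂, hmax⟩ := hK.exists_isMaxOn ⟨z₁, rfl⟩ Complex.continuous_re.continuousOn
  have hz₂' : f z₂ = f z₁ := hz₂
  have hz₂A : z₂ ∉ A := fun h => by linarith [hA z₂ h]
  obtain ⟨r, hr, hav⟩ := hsub z₂ hz₂A
  -- The average over the circle is at least the maximum, so `f` is maximal on the whole circle.
  have hfr : f (z₂ + r) = f z₁ := by
    by_contra hne
    have hlt : f (z₂ + r) < f z₁ := lt_of_le_of_ne (hz₁ _) hne
    have hc : Continuous fun θ : ℝ => f (circleMap z₂ r θ) := hf.comp (continuous_circleMap _ _)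
    have hint : ∫ θ in (0 : ℝ)..2 * Real.pi, f (circleMap z₂ r θ)
        < ∫ θ in (0 : ℝ)..2 * Real.pi, f z₁ := by
      refine intervalIntegral.integral_lt_integral_of_continuousOn_of_le_of_exists_lt
        Real.two_pi_pos hc.continuousOn continuousOn_const (fun θ _ => hz₁ _)
        ⟨0, ⟨le_rfl, Real.two_pi_pos.le⟩, ?_⟩
      simpa [circleMap] using hlt
    rw [hz₂', Real.circleAverage_def, smul_eq_mul] at hav
    rw [intervalIntegral.integral_const, smul_eq_mul, sub_zero] at hint
    have h2 := mul_lt_mul_of_pos_left hint (inv_pos.2 Real.two_pi_pos)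
    rw [inv_mul_cancel_left₀ Real.two_pi_pos.ne'] at h2
    linarith
  have := hmax (show z₂ + r ∈ {w | f w = f z₁} from hfr)
  simp at this
  linarith

/-- The logarithmic potential of a measure on the real line as a real-valued function on `ℂ`. It
is meaningful where the logarithmic kernel is integrable. -/
noncomputable def linePotential (μ : Measure ℝ) (z : ℂ) : ℝ := ∫ t, -Real.log ‖z - t‖ ∂μ

/-- `μ` is a finite atomless measure carried by `[-R, R]`, the logarithmic kernel is integrable at
every point of the plane, and the potential of `μ` is continuous on `ℂ`. -/
structure HasContinuousPotential (μ : Measure ℝ) (R : ℝ) : Prop where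
  finite : IsFiniteMeasure μ
  noAtoms : NullSingletonClass μ
  radius_pos : 0 < R
  ae_abs_le : ∀ᵐ t ∂μ, |t| ≤ R
  integrable : ∀ z : ℂ, Integrable (fun t : ℝ => Real.log ‖z - t‖) μ
  continuous : Continuous (linePotential μ)

theorem measurable_log_norm_sub :
    Measurable fun p : ℂ × ℝ => Real.log ‖p.1 - p.2‖ := by
  apply Real.measurable_log.comp
  apply Continuous.measurable
  fun_prop

/-- Fubini reduces the circle averages of a potential to those of the logarithm. -/
theorem HasContinuousPotential.circleAverage_eq (h : HasContinuousPotential μ R) (c : ℂ) {r : ℝ}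
    (hr : 0 < r) : Real.circleAverage (linePotential μ) c r =
      ∫ t, -(Real.log r + Real.posLog (r⁻¹ * ‖c - t‖)) ∂μ := by
  have := h.finite
  have hR := h.radius_pos
  -- `D` bounds the distances between the circle and the carrier of `μ`, so that `log D - log` is
  -- nonnegative and its joint integrability can be read off from the iterated integral.
  set D := ‖c‖ + r + R + 1 with hD
  have hD1 : 1 ≤ D := by have := norm_nonneg c; linarith
  have hnorm : ∀ θ t : ℝ, |t| ≤ R → ‖circleMap c r θ - t‖ ≤ D := by
    intro θ t ht
    have h1 : ‖circleMap c r θ‖ ≤ ‖c‖ + r := by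
      have h3 : ‖circleMap c r θ - c‖ = r := by simp [circleMap, abs_of_pos hr]
      have h4 := norm_add_le (circleMap c r θ - c) c
      rw [sub_add_cancel] at h4
      linarith
    calc _ ≤ ‖circleMap c r θ‖ + ‖(t : ℂ)‖ := norm_sub_le _ _
      _ ≤ D := by rw [Complex.norm_real, Real.norm_eq_abs]; linarith
  have hpos : ∀ θ t : ℝ, |t| ≤ R → 0 ≤ Real.log D - Real.log ‖circleMap c r θ - t‖ := by
    intro θ t ht
    rcases (norm_nonneg (circleMap c r θ - t)).eq_or_lt with h0 | h0
    · rw [← h0, Real.log_zero, sub_zero]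
      exact Real.log_nonneg hD1
    · linarith [Real.log_le_log h0 (hnorm θ t ht)]
  have hmeas : Measurable fun p : ℝ × ℝ => Real.log ‖circleMap c r p.1 - p.2‖ :=
    measurable_log_norm_sub.comp
      (((continuous_circleMap c r).measurable.comp measurable_fst).prodMk measurable_snd)
  have hcont : Continuous fun θ : ℝ => linePotential μ (circleMap c r θ) :=
    h.continuous.comp (continuous_circleMap c r)
  have hi : ∀ θ : ℝ, Integrable (fun t : ℝ => Real.log D - Real.log ‖circleMap c r θ - t‖) μ :=
    fun θ => (integrable_const (Real.log D)).sub (h.integrable (circleMap c r θ))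
  have hmeas' : Measurable fun p : ℝ × ℝ => Real.log D - Real.log ‖circleMap c r p.1 - p.2‖ :=
    measurable_const.sub hmeas
  have hint : Integrable (fun p : ℝ × ℝ => Real.log D - Real.log ‖circleMap c r p.1 - p.2‖)
      ((volume.restrict (Set.Ioc 0 (2 * Real.pi))).prod μ) := by
    rw [integrable_prod_iff hmeas'.aestronglyMeasurable]
    refine ⟨.of_forall hi, ?_⟩
    have heq : ∀ θ : ℝ, ∫ t, ‖Real.log D - Real.log ‖circleMap c r θ - t‖‖ ∂μ =
        μ.real Set.univ * Real.log D + linePotential μ (circleMap c r θ) := by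
      intro θ
      rw [linePotential, integral_neg, ← sub_eq_add_neg, ← smul_eq_mul, ← integral_const,
        ← integral_sub (integrable_const _) (h.integrable (circleMap c r θ))]
      refine integral_congr_ae ?_
      filter_upwards [h.ae_abs_le] with t ht
      exact Real.norm_of_nonneg (hpos θ t ht)
    simp only [heq]
    exact ((continuous_const.add hcont).integrableOn_Icc (a := 0)
      (b := 2 * Real.pi)).mono_set Set.Ioc_subset_Icc_self
  have hint' : Integrable (Function.uncurry fun θ t : ℝ => -Real.log ‖circleMap c r θ - t‖)
      ((volume.restrict (Set.Ioc 0 (2 * Real.pi))).prod μ) := by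
    refine (hint.sub (integrable_const (Real.log D))).congr (.of_forall fun p => ?_)
    simp [Function.uncurry]
  rw [Real.circleAverage_def, intervalIntegral.integral_of_le Real.two_pi_pos.le]
  simp only [linePotential]
  rw [integral_integral_swap hint', smul_eq_mul, ← integral_const_mul]
  refine integral_congr_ae (.of_forall fun t => ?_)
  have := circleAverage_log_norm_sub_const_eq_log_radius_add_posLog (a := (t : ℂ)) (c := c) hr.ne'
  rw [Real.circleAverage_def, intervalIntegral.integral_of_le Real.two_pi_pos.le,
    smul_eq_mul] at this
  simp only [integral_neg, mul_neg]
  rw [this]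

/-- Potentials are superharmonic. -/
theorem HasContinuousPotential.circleAverage_le (h : HasContinuousPotential μ R) (c : ℂ) {r : ℝ}
    (hr : 0 < r) : Real.circleAverage (linePotential μ) c r ≤ linePotential μ c := by
  have := h.finite
  have hatom := h.noAtoms
  rw [h.circleAverage_eq c hr, linePotential]
  have hne : ∀ᵐ t : ℝ ∂μ, 0 < ‖c - t‖ := by
    filter_upwards [compl_mem_ae_iff.2 (measure_singleton (μ := μ) c.re)] with t ht
    refine norm_pos_iff.2 (sub_ne_zero.2 fun hc => ht ?_)
    simp [hc]
  have hlog : ∀ᵐ t : ℝ ∂μ, -max (Real.log r) (Real.log ‖c - t‖) =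
      -(Real.log r + Real.posLog (r⁻¹ * ‖c - t‖)) := by
    filter_upwards [hne] with t ht
    rw [Real.posLog_apply, ← max_add_add_left, add_zero,
      Real.log_mul (by positivity) ht.ne', Real.log_inv, add_neg_cancel_left]
  have hmax : Integrable (fun t : ℝ => -max (Real.log r) (Real.log ‖c - t‖)) μ :=
    ((integrable_const (Real.log r)).sup (h.integrable c)).neg
  rw [← integral_congr_ae hlog]
  exact integral_mono hmax (h.integrable c).neg fun t => neg_le_neg (le_max_right _ _)

/-- Potentials are harmonic off a closed set carrying the measure. -/
theorem HasContinuousPotential.circleAverage_eq_of_le (h : HasContinuousPotential μ R) (c : ℂ)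
    {r : ℝ} (hr : 0 < r) (hrc : ∀ᵐ t : ℝ ∂μ, r ≤ ‖c - t‖) :
    Real.circleAverage (linePotential μ) c r = linePotential μ c := by
  rw [h.circleAverage_eq c hr, linePotential]
  refine integral_congr_ae ?_
  filter_upwards [hrc] with t ht
  have h1 : 1 ≤ r⁻¹ * ‖c - t‖ := by rwa [← div_eq_inv_mul, one_le_div hr]
  have h0 : 0 < ‖c - t‖ := hr.trans_le ht
  rw [Real.posLog_eq_log (by rwa [abs_of_nonneg (by positivity)]),
    Real.log_mul (by positivity) h0.ne', Real.log_inv]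
  ring

/-- Over a circle enclosing the measure, the average of the potential depends only on the mass. -/
theorem HasContinuousPotential.circleAverage_zero_eq (h : HasContinuousPotential μ R) :
    Real.circleAverage (linePotential μ) 0 R = -(μ.real Set.univ * Real.log R) := by
  have hR := h.radius_pos
  rw [h.circleAverage_eq 0 hR, ← smul_eq_mul, ← integral_const, ← integral_neg]
  refine integral_congr_ae ?_
  filter_upwards [h.ae_abs_le] with t ht
  have h1 : Real.posLog (R⁻¹ * ‖0 - (t : ℂ)‖) = 0 := by
    rw [Real.posLog_eq_zero_iff, zero_sub, norm_neg, Complex.norm_real, Real.norm_eq_abs,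
      abs_mul, abs_abs, abs_of_pos (inv_pos.2 hR), ← div_eq_inv_mul]
    exact div_le_one_of_le₀ ht hR.le
  rw [h1, add_zero]

/-- Far from the measure the potential is `-m log ‖z‖` up to a bounded error, with `m` the mass. -/
theorem HasContinuousPotential.abs_add_log_le (h : HasContinuousPotential μ R) {z : ℂ}
    (hz : 2 * R ≤ ‖z‖) :
    |linePotential μ z + μ.real Set.univ * Real.log ‖z‖| ≤ μ.real Set.univ * Real.log 2 := by
  have := h.finite
  have hR := h.radius_pos
  have hz0 : 0 < ‖z‖ := by linarith
  have hb : ∀ᵐ t : ℝ ∂μ, ‖-Real.log ‖z - t‖ + Real.log ‖z‖‖ ≤ Real.log 2 := by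
    filter_upwards [h.ae_abs_le] with t ht
    have ht' : ‖(t : ℂ)‖ ≤ R := by rwa [Complex.norm_real, Real.norm_eq_abs]
    have h1 := norm_sub_le z t
    have h2 := norm_sub_norm_le z (t : ℂ)
    have h3 : 0 < ‖z - t‖ := by linarith
    have h4 : Real.log ‖z - t‖ ≤ Real.log 2 + Real.log ‖z‖ := by
      rw [← Real.log_mul two_ne_zero hz0.ne']
      exact Real.log_le_log h3 (by linarith)
    have h5 : Real.log ‖z‖ ≤ Real.log 2 + Real.log ‖z - t‖ := by
      rw [← Real.log_mul two_ne_zero h3.ne']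
      exact Real.log_le_log hz0 (by linarith)
    exact abs_le.2 ⟨by linarith, by linarith⟩
  have heq : linePotential μ z + μ.real Set.univ * Real.log ‖z‖ =
      ∫ t : ℝ, (-Real.log ‖z - t‖ + Real.log ‖z‖) ∂μ := by
    rw [integral_add (f := fun t : ℝ => -Real.log ‖z - t‖) (h.integrable z).neg
      (integrable_const _), integral_const, smul_eq_mul,
      linePotential]
  rw [heq, ← Real.norm_eq_abs, mul_comm]
  exact norm_integral_le_of_norm_le_const hb

/-! ### Domination of potentials -/

theorem circleAverage_mul_sub_sub {f g : ℂ → ℝ} (hf : Continuous f) (hg : Continuous g)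
    (a k : ℝ) (c : ℂ) (r : ℝ) : Real.circleAverage (fun z => a * f z - g z - k) c r =
      a * Real.circleAverage f c r - Real.circleAverage g c r - k := by
  have hfi : CircleIntegrable (fun z => a * f z) c r :=
    (continuous_const.mul hf).continuousOn.circleIntegrable'
  have hgi : CircleIntegrable g c r := hg.continuousOn.circleIntegrable'
  rw [Real.circleAverage_fun_sub (f₁ := fun z => a * f z - g z) (hfi.sub hgi)
      (circleIntegrable_const k c r),
    Real.circleAverage_fun_sub hfi hgi, Real.circleAverage_const]
  congr 2
  exact Real.circleAverage_fun_smul (a := a) (f := f)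

theorem tendsto_log_norm_cocompact :
    Tendsto (fun z : ℂ => Real.log ‖z‖) (cocompact ℂ) atTop :=
  Real.tendsto_log_atTop.comp tendsto_norm_cocompact_atTop

/-- Domination principle. Replacing the first potential by a slightly larger multiple makes the
difference tend to `-∞` at infinity, so that the maximum principle applies even when the two
masses are equal. -/
theorem HasContinuousPotential.le_of_le_on (h₁ : HasContinuousPotential μ₁ R₁)
    (h₂ : HasContinuousPotential μ₂ R₂) {A : Set ℂ} (hA : IsCompact A)
    (hμA : ∀ᵐ t : ℝ ∂μ₁, (t : ℂ) ∈ A) (hmass : μ₂.real Set.univ ≤ μ₁.real Set.univ)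
    (hpos : 0 < μ₁.real Set.univ) {c : ℝ}
    (hle : ∀ z ∈ A, linePotential μ₁ z ≤ linePotential μ₂ z + c) (z : ℂ) :
    linePotential μ₁ z ≤ linePotential μ₂ z + c := by
  obtain ⟨B, hB⟩ := hA.bddAbove_image h₁.continuous.continuousOn
  replace hB : ∀ z ∈ A, linePotential μ₁ z ≤ B := fun z hz => hB ⟨z, hz, rfl⟩
  have key : ∀ ε > 0, (1 + ε) * linePotential μ₁ z - linePotential μ₂ z - (c + ε * B) ≤ 0 := by
    intro ε hε
    refine nonpos_of_le_circleAverage (A := A)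
      (f := fun z => (1 + ε) * linePotential μ₁ z - linePotential μ₂ z - (c + ε * B))
      (((continuous_const.mul h₁.continuous).sub h₂.continuous).sub continuous_const)
      ?_ ?_ ?_ z
    · intro w hw
      have := mul_le_mul_of_nonneg_left (hB w hw) hε.le
      linarith [hle w hw]
    · set X := (1 + ε) * (μ₁.real Set.univ * Real.log 2) + μ₂.real Set.univ * Real.log 2
        - (c + ε * B) with hX
      filter_upwards [tendsto_norm_cocompact_atTop.eventually_ge_atTop (2 * R₁),
        tendsto_norm_cocompact_atTop.eventually_ge_atTop (2 * R₂),
        tendsto_log_norm_cocompact.eventually_ge_atTop 0,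
        tendsto_log_norm_cocompact.eventually_ge_atTop (X / (ε * μ₁.real Set.univ))]
        with w hw₁ hw₂ hw₀ hwX
      have e₁ := (abs_le.1 (h₁.abs_add_log_le hw₁)).2
      have e₂ := (abs_le.1 (h₂.abs_add_log_le hw₂)).1
      rw [div_le_iff₀ (by positivity)] at hwX
      have e₃ := mul_le_mul_of_nonneg_left e₁ (by linarith : 0 ≤ 1 + ε)
      have e₄ := mul_le_mul_of_nonneg_right hmass hw₀
      nlinarith
    · intro w hw
      obtain ⟨r, hr, hrA⟩ := Metric.isOpen_iff.1 hA.isClosed.isOpen_compl w hw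
      refine ⟨r, hr, ?_⟩
      rw [circleAverage_mul_sub_sub h₁.continuous h₂.continuous,
        h₁.circleAverage_eq_of_le w hr ?_]
      · linarith [h₂.circleAverage_le w hr]
      · filter_upwards [hμA] with t ht
        by_contra! hlt
        exact hrA (by rwa [Metric.mem_ball, dist_comm, dist_eq_norm]) ht
  -- Let `ε → 0`: a positive gap `d` at `z` contradicts `key` for `ε = d / (2 N)`.
  by_contra! hlt
  set d := linePotential μ₁ z - (linePotential μ₂ z + c) with hd
  have hd0 : 0 < d := by linarith
  set N := |B - linePotential μ₁ z| + 1 with hN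
  have hN0 : 0 < N := by positivity
  have hk := key (d / (2 * N)) (by positivity)
  have h1 : d / (2 * N) * (B - linePotential μ₁ z) ≤ d / (2 * N) * N :=
    mul_le_mul_of_nonneg_left (by linarith [le_abs_self (B - linePotential μ₁ z)])
      (by positivity)
  have h2 : d / (2 * N) * N = d / 2 := by field_simp
  linarith

/-- If the potential of a measure, up to constants, lies below the potential of a measure with
mass smaller by `δ`, then the gap is at least a multiple of `δ log ‖z‖` off a disc carrying the
larger measure. The factor `1 / 2` makes the comparison function grow strictly slower than the
gap. -/
theorem HasContinuousPotential.mul_log_le_sub (h₁ : HasContinuousPotential μ₁ R₁)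
    (h₂ : HasContinuousPotential μ₂ R) {δ k : ℝ} (hδ : 0 < δ)
    (hmass : μ₂.real Set.univ = μ₁.real Set.univ + δ)
    (hle : ∀ z, linePotential μ₂ z ≤ linePotential μ₁ z + k) {z : ℂ} (hz : R ≤ ‖z‖) :
    δ / 2 * (Real.log ‖z‖ - Real.log R) ≤ linePotential μ₁ z + k - linePotential μ₂ z := by
  have hR := h₂.radius_pos
  have hpos : ∀ w : ℂ, 0 < max ‖w‖ R := fun w => lt_max_of_lt_right hR
  have hgc : Continuous fun w : ℂ => Real.log (max ‖w‖ R) :=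
    (continuous_norm.max continuous_const).log fun w => (hpos w).ne'
  -- `log (max ‖w‖ R)` is a continuous subharmonic function that is constant on the disc.
  have key := nonpos_of_le_circleAverage (A := Metric.closedBall 0 R)
    (f := fun w => δ / 2 * Real.log (max ‖w‖ R) - (linePotential μ₁ w - linePotential μ₂ w) -
      (k + δ / 2 * Real.log R))
    (((continuous_const.mul hgc).sub (h₁.continuous.sub h₂.continuous)).sub continuous_const)
    ?_ ?_ ?_ z
  · simp only [max_eq_left hz] at key
    linarith
  · intro w hw
    rw [max_eq_right (by simpa using hw)]
    linarith [hle w]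
  · set X := μ₁.real Set.univ * Real.log 2 + μ₂.real Set.univ * Real.log 2
      - (k + δ / 2 * Real.log R) with hX
    filter_upwards [tendsto_norm_cocompact_atTop.eventually_ge_atTop (2 * R₁),
      tendsto_norm_cocompact_atTop.eventually_ge_atTop (2 * R),
      tendsto_log_norm_cocompact.eventually_ge_atTop (X / (δ / 2))] with w hw₁ hw₂ hwX
    have e₁ := (abs_le.1 (h₁.abs_add_log_le hw₁)).1
    have e₂ := (abs_le.1 (h₂.abs_add_log_le hw₂)).2
    rw [div_le_iff₀ (by positivity)] at hwX
    rw [max_eq_left (by linarith)]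
    rw [hmass] at e₂ hX
    linarith
  · intro w hw
    have hw' : R < ‖w‖ := by simpa using hw
    have hr : 0 < ‖w‖ - R := by linarith
    refine ⟨‖w‖ - R, hr, ?_⟩
    rw [circleAverage_mul_sub_sub (g := fun w => linePotential μ₁ w - linePotential μ₂ w) hgc
        (h₁.continuous.sub h₂.continuous),
      Real.circleAverage_fun_sub h₁.continuous.continuousOn.circleIntegrable'
        h₂.continuous.continuousOn.circleIntegrable', h₂.circleAverage_eq_of_le w hr ?_]
    · have e₁ := h₁.circleAverage_le w hr
      have e₂ : Real.log ‖w‖ ≤ Real.circleAverage (fun w : ℂ => Real.log (max ‖w‖ R)) w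
          (‖w‖ - R) := by
        have e₃ := circleAverage_log_norm_sub_const_eq_log_radius_add_posLog (a := (0 : ℂ))
          (c := w) hr.ne'
        have e₄ : Real.log ‖w‖ ≤ Real.log (‖w‖ - R) +
            Real.posLog ((‖w‖ - R)⁻¹ * ‖w - 0‖) := by
          rw [sub_zero, Real.posLog_apply, ← max_add_add_left,
            Real.log_mul (by positivity) (hR.trans hw').ne', Real.log_inv, add_neg_cancel_left]
          exact le_max_right _ _
        rw [← e₃] at e₄
        refine e₄.trans (Real.circleAverage_mono (circleIntegrable_log_norm_sub_const _)
          hgc.continuousOn.circleIntegrable' fun x hx => ?_)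
        have hx0 : 0 < ‖x‖ := by
          have e₅ : ‖x - w‖ = ‖w‖ - R := by
            rw [mem_sphere_iff_norm, abs_of_pos hr] at hx
            exact hx
          have e₆ := norm_sub_norm_le w x
          rw [norm_sub_rev] at e₆
          linarith
        simpa using Real.log_le_log hx0 (le_max_left _ _)
      rw [max_eq_left hw'.le]
      have := mul_le_mul_of_nonneg_left e₂ (by positivity : 0 ≤ δ / 2)
      linarith
    · filter_upwards [h₂.ae_abs_le] with t ht
      have e₁ := norm_sub_norm_le w (t : ℂ)
      rw [Complex.norm_real, Real.norm_eq_abs] at e₁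
      linarith

/-! ### Continuity of potentials -/

/-- The truncation error of the logarithm at distance `r` is at most the error at a distance
`r' ≤ 2 r` for twice the truncation radius. -/
theorem log_max_sub_log_le {r r' a : ℝ} (hr' : 0 < r') (ha : 0 < a) (h : r' ≤ 2 * r) :
    Real.log (max r a) - Real.log r ≤ Real.log (max r' (2 * a)) - Real.log r' := by
  have hr : 0 < r := by linarith
  have h1 : Real.log (max r a * r') ≤ Real.log (max r' (2 * a) * r) := by
    refine Real.log_le_log (by positivity) ?_
    rcases max_cases r a with ⟨h2, h3⟩ | ⟨h2, h3⟩ <;> rw [h2]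
    · rw [mul_comm]
      exact mul_le_mul_of_nonneg_right (le_max_left _ _) hr.le
    · calc a * r' ≤ a * (2 * r) := mul_le_mul_of_nonneg_left h ha.le
        _ = 2 * a * r := by ring
        _ ≤ _ := mul_le_mul_of_nonneg_right (le_max_right _ _) hr.le
  rw [Real.log_mul (by positivity) hr'.ne', Real.log_mul (by positivity) hr.ne'] at h1
  linarith

/-- Evans–Vasilesco theorem: a potential that is finite and continuous on a compact set carrying
the measure is continuous on the whole plane. By Dini's theorem the truncated potentials converge
uniformly on that set, and comparing a point with the nearest point of the set transports
the uniform convergence to the plane. -/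
theorem hasContinuousPotential_of_continuousOn [IsFiniteMeasure μ] [NullSingletonClass μ]
    {S : Set ℝ} (hS : IsCompact S) (hS0 : S.Nonempty) (hμS : ∀ᵐ t ∂μ, t ∈ S) (hR : 0 < R)
    (hSR : ∀ t ∈ S, |t| ≤ R)
    (hint : ∀ x ∈ S, Integrable (fun t : ℝ => Real.log ‖(x : ℂ) - t‖) μ)
    (hcont : ContinuousOn (fun x : ℝ => linePotential μ x) S) :
    HasContinuousPotential μ R := by
  have hres : μ.restrict S = μ := Measure.restrict_eq_self_of_ae_mem hμS
  have hne : ∀ x : ℝ, ∀ᵐ t : ℝ ∂μ, 0 < ‖(x : ℂ) - t‖ := by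
    intro x
    filter_upwards [compl_mem_ae_iff.2 (measure_singleton (μ := μ) x)] with t ht
    exact norm_pos_iff.2 (sub_ne_zero.2 fun hc => ht (Complex.ofReal_injective hc).symm)
  -- The kernels are truncated at the radii `e m = 2⁻ᵐ`.
  set e : ℕ → ℝ := fun m => (1 / 2) ^ m with he
  have he0 : ∀ m, 0 < e m := fun m => by positivity
  have he2 : ∀ m, 2 * e (m + 1) = e m := fun m => by simp only [he, pow_succ]; ring
  have he1 : ∀ m, e m ≤ 1 := fun m => pow_le_one₀ (by norm_num) (by norm_num)
  have hea : Antitone e := fun i j hij => pow_le_pow_of_le_one (by norm_num) (by norm_num) hij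
  set T : ℕ → ℂ → ℝ := fun m z => ∫ t : ℝ, -Real.log (max ‖z - t‖ (e m)) ∂μ with hT
  have hkc : ∀ m, Continuous fun p : ℂ × ℝ => -Real.log (max ‖p.1 - p.2‖ (e m)) := by
    intro m
    refine (Continuous.log (by fun_prop) fun p => ?_).neg
    exact (lt_max_of_lt_right (he0 m)).ne'
  have hTc : ∀ m, Continuous (T m) := by
    intro m
    have := continuous_parametric_integral_of_continuous (μ := μ)
      (f := fun (z : ℂ) (t : ℝ) => -Real.log (max ‖z - t‖ (e m))) (hkc m) hS
    rwa [hres] at this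
  have hTi : ∀ m (z : ℂ), Integrable (fun t : ℝ => -Real.log (max ‖z - t‖ (e m))) μ := by
    intro m z
    have h1 : Continuous fun t : ℝ => -Real.log (max ‖z - t‖ (e m)) :=
      (hkc m).comp (continuous_const.prodMk continuous_id)
    have := h1.continuousOn.integrableOn_compact (μ := μ) hS
    rwa [IntegrableOn, hres] at this
  -- A nearest point `x` of `S` to `z` is at most twice as far from the points of `S` as `z` is.
  have hnear : ∀ z : ℂ, ∃ x ∈ S, ∀ t ∈ S, ‖(x : ℂ) - t‖ ≤ 2 * ‖z - t‖ := by
    intro z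
    have hd : Continuous fun t : ℝ => ‖z - t‖ := by fun_prop
    obtain ⟨x, hx, hmin⟩ := hS.exists_isMinOn hS0 hd.continuousOn
    refine ⟨x, hx, fun t ht => ?_⟩
    have h1 : ‖z - x‖ ≤ ‖z - t‖ := hmin ht
    have h2 := norm_sub_le (z - (t : ℂ)) (z - x)
    rw [sub_sub_sub_cancel_left] at h2
    linarith
  have hI : ∀ z : ℂ, Integrable (fun t : ℝ => Real.log ‖z - t‖) μ := by
    intro z
    obtain ⟨x, hx, hxt⟩ := hnear z
    have hb : Integrable (fun t : ℝ => ‖Real.log ‖(x : ℂ) - t‖‖ + Real.log 2 +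
        Real.log (‖z‖ + R + 1)) μ :=
      (((hint x hx).norm).add (integrable_const _)).add (integrable_const _)
    refine hb.mono' (measurable_log_norm_sub.comp
      (measurable_const.prodMk measurable_id)).aestronglyMeasurable ?_
    filter_upwards [hμS, hne x] with t ht h0
    have h1 := hxt t ht
    have h2 : ‖z - t‖ ≤ ‖z‖ + R + 1 := by
      have := norm_sub_le z t
      rw [Complex.norm_real, Real.norm_eq_abs] at this
      linarith [hSR t ht]
    have h3 : 0 < ‖z - t‖ := by linarith
    have h4 := Real.log_le_log h3 h2
    have h5 : Real.log ‖(x : ℂ) - t‖ ≤ Real.log 2 + Real.log ‖z - t‖ := by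
      rw [← Real.log_mul two_ne_zero h3.ne']
      exact Real.log_le_log h0 h1
    have h6 : 0 ≤ Real.log (‖z‖ + R + 1) := Real.log_nonneg (by linarith [norm_nonneg z])
    have h7 : 0 ≤ Real.log 2 := Real.log_nonneg one_le_two
    rw [Real.norm_eq_abs, Real.norm_eq_abs]
    refine abs_le.2 ⟨?_, ?_⟩
    · linarith [neg_abs_le (Real.log ‖(x : ℂ) - t‖)]
    · linarith [abs_nonneg (Real.log ‖(x : ℂ) - t‖)]
  have hsub : ∀ m (z : ℂ), linePotential μ z - T m z =
      ∫ t : ℝ, (Real.log (max ‖z - t‖ (e m)) - Real.log ‖z - t‖) ∂μ := by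
    intro m z
    have h1 : linePotential μ z - T m z = ∫ t : ℝ, (-Real.log ‖z - t‖ -
        -Real.log (max ‖z - t‖ (e m))) ∂μ := (integral_sub (hI z).neg (hTi m z)).symm
    rw [h1]
    refine integral_congr_ae (.of_forall fun t => ?_)
    ring
  have hdi : ∀ m (z : ℂ), Integrable
      (fun t : ℝ => Real.log (max ‖z - t‖ (e m)) - Real.log ‖z - t‖) μ := fun m z => by
    refine ((hTi m z).neg.sub (hI z)).congr (.of_forall fun t => ?_)
    simp
  have hzx : ∀ z : ℂ, ∃ x ∈ S, ∀ m, 0 ≤ linePotential μ z - T (m + 1) z ∧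
      linePotential μ z - T (m + 1) z ≤ linePotential μ x - T m x := by
    intro z
    obtain ⟨x, hx, hxt⟩ := hnear z
    refine ⟨x, hx, fun m => ?_⟩
    have hz0 : ∀ᵐ t : ℝ ∂μ, 0 < ‖z - t‖ := by
      filter_upwards [hμS, hne x] with t ht h0
      linarith [hxt t ht]
    rw [hsub, hsub]
    constructor
    · refine integral_nonneg_of_ae ?_
      filter_upwards [hz0] with t h0
      exact sub_nonneg.2 (Real.log_le_log h0 (le_max_left _ _))
    · refine integral_mono_ae (hdi _ _) (hdi _ _) ?_
      filter_upwards [hμS, hne x] with t ht h0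
      have := log_max_sub_log_le h0 (he0 (m + 1)) (hxt t ht)
      rwa [he2] at this
  have hlim : ∀ x ∈ S, Tendsto (fun m => T m x) atTop (𝓝 (linePotential μ x)) := by
    intro x hx
    refine tendsto_integral_of_dominated_convergence _ (fun m => (hTi m x).aestronglyMeasurable)
      (hint x hx).norm (fun m => ?_) ?_
    · filter_upwards [hne x] with t h0
      rw [norm_neg, Real.norm_eq_abs, Real.norm_eq_abs]
      rcases le_total (e m) ‖(x : ℂ) - t‖ with h1 | h1
      · rw [max_eq_left h1]
      · rw [max_eq_right h1, abs_of_nonpos (Real.log_nonpos (he0 m).le (he1 m)),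
          abs_of_nonpos (Real.log_nonpos h0.le (h1.trans (he1 m)))]
        exact neg_le_neg (Real.log_le_log h0 h1)
    · filter_upwards [hne x] with t h0
      refine tendsto_const_nhds.congr' ?_
      have : Tendsto e atTop (𝓝 0) :=
        tendsto_pow_atTop_nhds_zero_of_lt_one (by norm_num) (by norm_num)
      filter_upwards [this.eventually_lt_const h0] with m hm
      rw [max_eq_left hm.le]
  have hmono : ∀ x ∈ S, Monotone fun m => T m x := by
    intro x _ i j hij
    refine integral_mono (hTi i x) (hTi j x) fun t => neg_le_neg ?_
    exact Real.log_le_log (lt_max_of_lt_right (he0 j)) (max_le_max_left _ (hea hij))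
  have hunif : TendstoUniformlyOn (fun m (x : ℝ) => T m x)
      (fun x : ℝ => linePotential μ x) atTop S :=
    Monotone.tendstoUniformlyOn_of_forall_tendsto hS
      (fun m => ((hTc m).comp Complex.continuous_ofReal).continuousOn) hmono hcont hlim
  have hunif' : TendstoUniformly (fun m z => T (m + 1) z) (linePotential μ) atTop := by
    rw [Metric.tendstoUniformly_iff]
    rw [Metric.tendstoUniformlyOn_iff] at hunif
    intro ε hε
    filter_upwards [hunif ε hε] with m hm z
    obtain ⟨x, hx, hxz⟩ := hzx z
    have h1 := hm x hx
    rw [Real.dist_eq] at h1 ⊢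
    rw [abs_of_nonneg (hxz m).1]
    exact ((hxz m).2.trans (le_abs_self _)).trans_lt h1
  exact ⟨inferInstance, inferInstance, hR, hμS.mono hSR, hI,
    hunif'.continuous (.of_forall fun m => hTc (m + 1))⟩

end

section

variable {W : ℝ → ℝ} {B : ℝ}

/-! ### The energy kernel -/

/-- `V` dominates every multiple of `log (1 + |x|)` up to an additive constant. For continuous `V`
this is the growth condition `V x / log |x| → ∞`. -/
def IsSuperlogarithmic (V : ℝ → ℝ) : Prop :=
  ∀ A : ℝ, ∃ B : ℝ, ∀ x : ℝ, A * Real.log (1 + |x|) ≤ V x + B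

theorem isSuperlogarithmic_of_tendsto {V : ℝ → ℝ} (hV : Continuous V)
    (hgrowth : Tendsto (fun x : ℝ => V x / Real.log |x|) (cocompact ℝ) atTop) :
    IsSuperlogarithmic V := by
  intro A
  have h1 : ∀ᶠ x : ℝ in cocompact ℝ, |A| * Real.log (1 + |x|) ≤ V x + |A| * Real.log 2 := by
    filter_upwards [hgrowth.eventually_ge_atTop |A|,
      tendsto_norm_cocompact_atTop.eventually_gt_atTop 1] with x hx hx1
    rw [Real.norm_eq_abs] at hx1
    rw [le_div_iff₀ (Real.log_pos hx1)] at hx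
    have h2 : Real.log (1 + |x|) ≤ Real.log 2 + Real.log |x| := by
      rw [← Real.log_mul two_ne_zero (by positivity)]
      exact Real.log_le_log (by positivity) (by linarith)
    have := mul_le_mul_of_nonneg_left h2 (abs_nonneg A)
    linarith
  obtain ⟨T, hT, hTs⟩ := mem_cocompact.1 h1
  have hc : Continuous fun x : ℝ => |A| * Real.log (1 + |x|) - V x :=
    (continuous_const.mul (Continuous.log (by fun_prop) fun x => by positivity)).sub hV
  obtain ⟨B, hB⟩ := hT.bddAbove_image hc.continuousOn
  refine ⟨max B (|A| * Real.log 2), fun x => ?_⟩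
  have h0 : 0 ≤ Real.log (1 + |x|) := Real.log_nonneg (by linarith [abs_nonneg x])
  refine (mul_le_mul_of_nonneg_right (le_abs_self A) h0).trans ?_
  by_cases hx : x ∈ T
  · have := hB ⟨x, hx, rfl⟩
    simp only at this
    linarith [le_max_left B (|A| * Real.log 2)]
  · have : |A| * Real.log (1 + |x|) ≤ V x + |A| * Real.log 2 := hTs hx
    linarith [le_max_right B (|A| * Real.log 2)]

theorem IsSuperlogarithmic.rescaledPotential {V : ℝ → ℝ} (h : IsSuperlogarithmic V) (γ : ℝ)
    {s : ℝ} (hs : 0 < s) : IsSuperlogarithmic (rescaledPotential V γ s) := by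
  intro A
  obtain ⟨B, hB⟩ := h (|A| * s)
  have ha : 0 < s ^ γ := Real.rpow_pos_of_pos hs γ
  set b := Real.log (1 + (s ^ γ)⁻¹) with hb
  refine ⟨B / s + |A| * b, fun x => ?_⟩
  have h1 : Real.log (1 + |x|) ≤ b + Real.log (1 + |s ^ γ * x|) := by
    rw [hb, ← Real.log_mul (by positivity) (by positivity)]
    refine Real.log_le_log (by positivity) ?_
    have h2 : (s ^ γ)⁻¹ * |s ^ γ * x| = |x| := by
      rw [abs_mul, abs_of_pos ha, inv_mul_cancel_left₀ ha.ne']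
    have h3 : 0 ≤ (s ^ γ)⁻¹ := by positivity
    nlinarith [abs_nonneg (s ^ γ * x)]
  have h0 : 0 ≤ Real.log (1 + |x|) := Real.log_nonneg (by linarith [abs_nonneg x])
  have h2 := hB (s ^ γ * x)
  have h3 := mul_le_mul_of_nonneg_left h1 (abs_nonneg A)
  have h4 := mul_le_mul_of_nonneg_right (le_abs_self A) h0
  have h5 : |A| * Real.log (1 + |s ^ γ * x|) ≤ V (s ^ γ * x) / s + B / s := by
    rw [← add_div, le_div_iff₀ hs]
    linarith
  simp only [LogGas.rescaledPotential]
  linarith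

/-- The energy kernel `W x + W y - log |x - y|`, shifted by a constant `B` chosen so that it is
nonnegative; its value on the diagonal is `∞`. -/
noncomputable def shiftedKernel (W : ℝ → ℝ) (B : ℝ) (x y : ℝ) : ENNReal :=
  (((W x + W y + B : ℝ) : EReal) - ENNReal.log (edist x y)).toENNReal

/-- `B` is a shift that makes the energy kernel nonnegative. Half of the bound absorbs
`log |x - y|`, the other half makes the kernel at least `log (1 + |x|)`, which gives tightness
and compact supports. -/
def IsKernelShift (W : ℝ → ℝ) (B : ℝ) : Prop :=
  ∀ x : ℝ, 2 * Real.log (1 + |x|) ≤ W x + B / 2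

theorem log_edist_of_ne {x y : ℝ} (h : x ≠ y) :
    ENNReal.log (edist x y) = (Real.log |x - y| : ℝ) := by
  rw [edist_dist, ENNReal.log_ofReal_of_pos (dist_pos.2 h), Real.dist_eq]

theorem shiftedKernel_self (x : ℝ) : shiftedKernel W B x x = ⊤ := by
  rw [shiftedKernel, edist_self, ENNReal.log_zero, EReal.sub_bot (EReal.coe_ne_bot _),
    EReal.toENNReal_top]

theorem shiftedKernel_of_ne {x y : ℝ} (h : x ≠ y) :
    shiftedKernel W B x y = ENNReal.ofReal (W x + W y + B - Real.log |x - y|) := by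
  rw [shiftedKernel, log_edist_of_ne h, ← EReal.coe_sub, EReal.real_coe_toENNReal]

theorem shiftedKernel_comm (x y : ℝ) : shiftedKernel W B x y = shiftedKernel W B y x := by
  rw [shiftedKernel, shiftedKernel, edist_comm, add_comm (W x)]

theorem continuous_shiftedKernel (hW : Continuous W) :
    Continuous fun p : ℝ × ℝ => shiftedKernel W B p.1 p.2 := by
  refine EReal.continuous_toENNReal.comp ?_
  have h1 : Continuous fun p : ℝ × ℝ => (((W p.1 + W p.2 + B : ℝ) : EReal)) :=
    continuous_coe_real_ereal.comp (by fun_prop)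
  have h2 : Continuous fun p : ℝ × ℝ => -ENNReal.log (edist p.1 p.2) :=
    continuous_neg.comp (ENNReal.continuous_log.comp continuous_edist)
  refine continuous_iff_continuousAt.2 fun p => ?_
  exact (EReal.continuousAt_add (Or.inl (EReal.coe_ne_top _)) (Or.inl (EReal.coe_ne_bot _))).comp₂
    h1.continuousAt h2.continuousAt

theorem measurable_shiftedKernel {X : Type*} [MeasurableSpace X] (hW : Continuous W) {f g : X → ℝ}
    (hf : Measurable f) (hg : Measurable g) :
    Measurable fun p => shiftedKernel W B (f p) (g p) := by
  have hK : Measurable fun p : ℝ × ℝ => shiftedKernel W B p.1 p.2 :=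
    (continuous_shiftedKernel hW).measurable
  generalize shiftedKernel W B = k at *
  exact hK.comp (hf.prodMk hg)

theorem log_abs_sub_le (x y : ℝ) :
    Real.log |x - y| ≤ Real.log (1 + |x|) + Real.log (1 + |y|) := by
  have hx := abs_nonneg x
  have hy := abs_nonneg y
  rcases (abs_nonneg (x - y)).eq_or_lt with h | h
  · rw [← h, Real.log_zero]
    exact add_nonneg (Real.log_nonneg (by linarith)) (Real.log_nonneg (by linarith))
  · rw [← Real.log_mul (by positivity) (by positivity)]
    refine Real.log_le_log h ((abs_sub x y).trans ?_)
    nlinarith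

theorem IsKernelShift.log_add_log_le (hB : IsKernelShift W B) (x y : ℝ) :
    Real.log (1 + |x|) + Real.log (1 + |y|) ≤ W x + W y + B - Real.log |x - y| := by
  linarith [hB x, hB y, log_abs_sub_le x y]

theorem IsKernelShift.ofReal_log_le (hB : IsKernelShift W B) (x y : ℝ) :
    ENNReal.ofReal (Real.log (1 + |x|)) ≤ shiftedKernel W B x y := by
  rcases eq_or_ne x y with rfl | h
  · rw [shiftedKernel_self]
    exact le_top
  · rw [shiftedKernel_of_ne h]
    refine ENNReal.ofReal_le_ofReal ?_
    have : 0 ≤ Real.log (1 + |y|) := Real.log_nonneg (by linarith [abs_nonneg y])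
    linarith [hB.log_add_log_le x y]

theorem IsKernelShift.nonneg (hB : IsKernelShift W B) (x y : ℝ) :
    0 ≤ ((W x + W y + B : ℝ) : EReal) - ENNReal.log (edist x y) := by
  rcases eq_or_ne x y with rfl | h
  · rw [edist_self, ENNReal.log_zero, EReal.sub_bot (EReal.coe_ne_bot _)]
    exact le_top
  · rw [log_edist_of_ne h, ← EReal.coe_sub]
    refine EReal.coe_nonneg.2 (le_trans ?_ (hB.log_add_log_le x y))
    exact add_nonneg (Real.log_nonneg (by linarith [abs_nonneg x]))
      (Real.log_nonneg (by linarith [abs_nonneg y]))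

theorem IsSuperlogarithmic.exists_isKernelShift {V : ℝ → ℝ} (h : IsSuperlogarithmic V) {s : ℝ}
    (hs : 0 < s) : ∃ B, 0 ≤ B ∧ IsKernelShift (fun x => V x / s) B := by
  obtain ⟨B, hB⟩ := h (2 * s)
  refine ⟨2 * (|B| / s), by positivity, fun x => ?_⟩
  have : V x / s + 2 * (|B| / s) / 2 = (V x + |B|) / s := by ring
  simp only [this]
  rw [le_div_iff₀ hs]
  linarith [hB x, le_abs_self B]

/-! ### The shifted energy -/

/-- The potential of `μ` for the shifted energy kernel. -/
noncomputable def kernelPotential (W : ℝ → ℝ) (B : ℝ) (μ : Measure ℝ) (x : ℝ) : ENNReal :=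
  ∫⁻ y, shiftedKernel W B x y ∂μ

/-- The mutual energy of two measures for the shifted energy kernel. -/
noncomputable def mutualEnergy (W : ℝ → ℝ) (B : ℝ) (η μ : Measure ℝ) : ENNReal :=
  ∫⁻ x, kernelPotential W B μ x ∂η

theorem measurable_kernelPotential (hW : Continuous W) (μ : Measure ℝ) [SFinite μ] :
    Measurable (kernelPotential W B μ) :=
  (continuous_shiftedKernel hW).measurable.lintegral_prod_right'

/-- An integrand bounded below by a constant may be shifted to be nonnegative. -/
theorem eintegral_eq_lintegral_sub {X : Type*} [MeasurableSpace X] {μ : Measure X}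
    [IsFiniteMeasure μ] {f : X → EReal} (hf : Measurable f) {b : ℝ} (hb : 0 ≤ b)
    (hfb : ∀ x, 0 ≤ f x + b) :
    eintegral μ f = ((∫⁻ x, (f x + b).toENNReal ∂μ : ENNReal) : EReal) -
      ((ENNReal.ofReal b * μ Set.univ : ENNReal) : EReal) := by
  have hpt : ∀ x, (f x).toENNReal + ENNReal.ofReal b =
      (f x + b).toENNReal + (-(f x)).toENNReal := by
    intro x
    have := hfb x
    induction hx : f x with
    | bot => rw [hx] at this; simp at this
    | top => simp
    | coe r =>
      rw [hx, ← EReal.coe_add, EReal.coe_nonneg] at this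
      rw [← EReal.coe_add, ← EReal.coe_neg, EReal.real_coe_toENNReal, EReal.real_coe_toENNReal,
        EReal.real_coe_toENNReal]
      rcases le_total 0 r with h | h
      · rw [ENNReal.ofReal_of_nonpos (neg_nonpos.2 h), add_zero, ENNReal.ofReal_add h hb]
      · rw [ENNReal.ofReal_of_nonpos h, zero_add, ← ENNReal.ofReal_add this (neg_nonneg.2 h)]
        congr 1
        ring
  have hmn : Measurable fun x => (-(f x)).toENNReal := hf.neg.ereal_toENNReal
  have hint := lintegral_congr (μ := μ) hpt
  rw [lintegral_add_right _ measurable_const, lintegral_const,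
    lintegral_add_right _ hmn] at hint
  have hneg : ∀ x, (-(f x)).toENNReal ≤ ENNReal.ofReal b := by
    intro x
    have := hfb x
    induction hx : f x with
    | bot => rw [hx] at this; simp at this
    | top => simp
    | coe r =>
      rw [hx, ← EReal.coe_add, EReal.coe_nonneg] at this
      rw [← EReal.coe_neg, EReal.real_coe_toENNReal]
      exact ENNReal.ofReal_le_ofReal (by linarith)
  have hb_fin : ENNReal.ofReal b * μ Set.univ ≠ ⊤ :=
    ENNReal.mul_ne_top ENNReal.ofReal_ne_top (measure_ne_top _ _)
  have hneg_fin : ∫⁻ x, (-(f x)).toENNReal ∂μ ≠ ⊤ := by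
    refine ne_top_of_le_ne_top hb_fin ?_
    rw [← lintegral_const]
    exact lintegral_mono hneg
  rw [eintegral]
  generalize (∫⁻ x, (f x).toENNReal ∂μ) = p at *
  generalize (∫⁻ x, (f x + b).toENNReal ∂μ) = q at *
  generalize (∫⁻ x, (-(f x)).toENNReal ∂μ) = n at *
  generalize ENNReal.ofReal b * μ Set.univ = m at *
  lift n to NNReal using hneg_fin
  lift m to NNReal using hb_fin
  induction p with
  | top =>
    have : q = ⊤ := by simpa using hint.symm
    rw [this]
    rfl
  | coe p =>
    have : q ≠ ⊤ := by
      rintro rfl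
      simp at hint
    lift q to NNReal using this
    have h1 : (p : ℝ) + m = q + n := by exact_mod_cast hint
    have h2 : ((p : ℝ) - n) = q - m := by linarith
    simp only [EReal.coe_nnreal_eq_coe_real, ← EReal.coe_sub, h2]

theorem kernelPotential_add (W : ℝ → ℝ) (B : ℝ) (μ ν : Measure ℝ) (x : ℝ) :
    kernelPotential W B (μ + ν) x = kernelPotential W B μ x + kernelPotential W B ν x :=
  lintegral_add_measure _ _ _

theorem kernelPotential_smul (W : ℝ → ℝ) (B : ℝ) (a : ENNReal) (μ : Measure ℝ) (x : ℝ) :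
    kernelPotential W B (a • μ) x = a * kernelPotential W B μ x :=
  lintegral_smul_measure _ _

theorem mutualEnergy_smul_left (W : ℝ → ℝ) (B : ℝ) (a : ENNReal) (η μ : Measure ℝ) :
    mutualEnergy W B (a • η) μ = a * mutualEnergy W B η μ :=
  lintegral_smul_measure _ _

theorem mutualEnergy_smul_right (hW : Continuous W) (a : ENNReal) (η μ : Measure ℝ) [SFinite μ] :
    mutualEnergy W B η (a • μ) = a * mutualEnergy W B η μ := by
  simp only [mutualEnergy, kernelPotential_smul]
  exact lintegral_const_mul _ (measurable_kernelPotential hW μ)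

theorem mutualEnergy_add_left (W : ℝ → ℝ) (B : ℝ) (η₁ η₂ μ : Measure ℝ) :
    mutualEnergy W B (η₁ + η₂) μ = mutualEnergy W B η₁ μ + mutualEnergy W B η₂ μ :=
  lintegral_add_measure _ _ _

theorem mutualEnergy_add_right (hW : Continuous W) (η μ₁ μ₂ : Measure ℝ) [SFinite μ₁] :
    mutualEnergy W B η (μ₁ + μ₂) = mutualEnergy W B η μ₁ + mutualEnergy W B η μ₂ := by
  simp only [mutualEnergy, kernelPotential_add]
  exact lintegral_add_left (measurable_kernelPotential hW μ₁) _

theorem mutualEnergy_comm (hW : Continuous W) (η μ : Measure ℝ) [SFinite η] [SFinite μ] :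
    mutualEnergy W B η μ = mutualEnergy W B μ η := by
  simp only [mutualEnergy, kernelPotential]
  rw [lintegral_lintegral_swap (continuous_shiftedKernel hW).measurable.aemeasurable]
  simp only [shiftedKernel_comm]

theorem mutualEnergy_mono {η₁ η₂ μ₁ μ₂ : Measure ℝ} (hη : η₁ ≤ η₂) (hμ : μ₁ ≤ μ₂) :
    mutualEnergy W B η₁ μ₁ ≤ mutualEnergy W B η₂ μ₂ :=
  lintegral_mono' hη fun _ => lintegral_mono' hμ le_rfl

/-- Among measures of a fixed mass, the energy and the shifted energy differ by a real constant, so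
they have the same minimizers. -/
theorem energy_eq_mutualEnergy_sub {V : ℝ → ℝ} (hV : Continuous V) {s : ℝ} (hs : 0 < s)
    (hB0 : 0 ≤ B) (hB : IsKernelShift (fun x => V x / s) B) {μ : Measure ℝ}
    (hμ : μ Set.univ = ENNReal.ofReal s) :
    energy V μ = (mutualEnergy (fun x => V x / s) B μ μ : EReal) - ((B * (s * s) : ℝ) : EReal) := by
  have hfin : IsFiniteMeasure μ := ⟨by rw [hμ]; exact ENNReal.ofReal_lt_top⟩
  have hreal : μ.real Set.univ = s := by rw [measureReal_def, hμ, ENNReal.toReal_ofReal hs.le]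
  have hW : Continuous fun x => V x / s := hV.div_const s
  have hadd : ∀ p : ℝ × ℝ, (((V p.1 + V p.2) / s : ℝ) : EReal) - ENNReal.log (edist p.1 p.2) + B =
      ((V p.1 / s + V p.2 / s + B : ℝ) : EReal) - ENNReal.log (edist p.1 p.2) := by
    intro p
    rw [sub_eq_add_neg, add_right_comm, ← EReal.coe_add, ← sub_eq_add_neg, add_div]
  rw [energy, hreal, eintegral_eq_lintegral_sub ?_ hB0 ?_]
  · simp only [hadd]
    congr 1
    · rw [mutualEnergy]
      simp only [kernelPotential]
      rw [← lintegral_prod _ (continuous_shiftedKernel hW).measurable.aemeasurable]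
      rfl
    · rw [← Set.univ_prod_univ, Measure.prod_prod, hμ, ← ENNReal.ofReal_mul hs.le,
        ← ENNReal.ofReal_mul hB0, EReal.coe_ennreal_ofReal, max_eq_left (by positivity)]
  · have h1 : Measurable fun p : ℝ × ℝ => (((V p.1 + V p.2) / s : ℝ) : EReal) :=
      (continuous_coe_real_ereal.comp (by fun_prop)).measurable
    have h2 : Measurable fun p : ℝ × ℝ => ENNReal.log (edist p.1 p.2) :=
      (ENNReal.continuous_log.comp continuous_edist).measurable
    exact h1.sub h2
  · intro p
    rw [hadd]
    exact hB.nonneg p.1 p.2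

theorem isEnergyMinimizer_iff {V : ℝ → ℝ} (hV : Continuous V) {s : ℝ} (hs : 0 < s)
    (hB0 : 0 ≤ B) (hB : IsKernelShift (fun x => V x / s) B) {μ : Measure ℝ} :
    IsEnergyMinimizer V s μ ↔ μ Set.univ = ENNReal.ofReal s ∧
      ∀ ν : Measure ℝ, ν Set.univ = ENNReal.ofReal s →
        mutualEnergy (fun x => V x / s) B μ μ ≤ mutualEnergy (fun x => V x / s) B ν ν := by
  refine and_congr_right fun hμ => forall_congr' fun ν => imp_congr_right fun hν => ?_
  rw [energy_eq_mutualEnergy_sub hV hs hB0 hB hμ, energy_eq_mutualEnergy_sub hV hs hB0 hB hν,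
    ← EReal.coe_ennreal_le_coe_ennreal_iff]
  refine ⟨fun h => ?_, fun h => EReal.sub_le_sub h le_rfl⟩
  have := add_le_add_left h ((B * (s * s) : ℝ) : EReal)
  rwa [EReal.sub_add_cancel, EReal.sub_add_cancel] at this

/-! ### Lebesgue measure on an interval has finite energy -/

theorem lintegral_neg_log_lt_top : ∫⁻ x : ℝ, ENNReal.ofReal (-Real.log |x|) < ⊤ := by
  have h1 : IntegrableOn (fun x : ℝ => -Real.log |x|) (Set.Ioc (-1) 1) := by
    simp only [Real.log_abs]
    exact (intervalIntegral.intervalIntegrable_log'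
      (a := -1) (b := 1)).neg.1
  have h2 : (fun x : ℝ => ENNReal.ofReal (-Real.log |x|)) =
      (Set.Ioc (-1 : ℝ) 1).indicator fun x : ℝ => ENNReal.ofReal (-Real.log |x|) := by
    refine (Set.indicator_eq_self.2 fun x hx => ?_).symm
    rw [Function.mem_support] at hx
    by_contra hn
    refine hx (ENNReal.ofReal_of_nonpos (neg_nonpos.2 (Real.log_nonneg ?_)))
    by_contra! hlt
    rw [abs_lt] at hlt
    exact hn ⟨hlt.1, hlt.2.le⟩
  rw [h2, lintegral_indicator measurableSet_Ioc]
  exact h1.lintegral_lt_top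

theorem lintegral_neg_log_sub (y : ℝ) :
    ∫⁻ x : ℝ, ENNReal.ofReal (-Real.log |x - y|) = ∫⁻ x : ℝ, ENNReal.ofReal (-Real.log |x|) :=
  lintegral_sub_right_eq_self (fun x : ℝ => ENNReal.ofReal (-Real.log |x|)) y

theorem mutualEnergy_volume_Icc_lt_top (hW : Continuous W) (a b : ℝ) :
    mutualEnergy W B (volume.restrict (Set.Icc a b)) (volume.restrict (Set.Icc a b)) < ⊤ := by
  obtain ⟨C, hC⟩ := (isCompact_Icc (a := a) (b := b)).bddAbove_image hW.continuousOn
  replace hC : ∀ x ∈ Set.Icc a b, W x ≤ C := fun x hx => hC ⟨x, hx, rfl⟩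
  set D := ENNReal.ofReal (C + C + B) with hD
  set L := ∫⁻ x : ℝ, ENNReal.ofReal (-Real.log |x|) with hL
  have hI : volume (Set.Icc a b) ≠ ⊤ := by simp
  have hbound : ∀ x ∈ Set.Icc a b,
      kernelPotential W B (volume.restrict (Set.Icc a b)) x ≤ D * volume (Set.Icc a b) + L := by
    intro x hx
    calc kernelPotential W B (volume.restrict (Set.Icc a b)) x
        ≤ ∫⁻ y in Set.Icc a b, (D + ENNReal.ofReal (-Real.log |y - x|)) := by
          refine lintegral_mono_ae ?_
          filter_upwards [ae_restrict_mem measurableSet_Icc,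
            compl_mem_ae_iff.2 (measure_singleton (μ := volume.restrict (Set.Icc a b)) x)]
            with y hy hyx
          rw [shiftedKernel_of_ne (Ne.symm hyx), abs_sub_comm x y]
          refine le_trans (ENNReal.ofReal_le_ofReal ?_) ENNReal.ofReal_add_le
          linarith [hC x hx, hC y hy]
      _ ≤ D * volume (Set.Icc a b) + L := by
          rw [lintegral_add_left measurable_const, setLIntegral_const, hL,
            ← lintegral_neg_log_sub x]
          gcongr
          exact Measure.restrict_le_self
  calc mutualEnergy W B (volume.restrict (Set.Icc a b)) (volume.restrict (Set.Icc a b))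
      ≤ ∫⁻ x in Set.Icc a b, (D * volume (Set.Icc a b) + L) :=
        setLIntegral_mono measurable_const hbound
    _ < ⊤ := by
        rw [setLIntegral_const]
        refine ENNReal.mul_lt_top (ENNReal.add_lt_top.2 ⟨?_, lintegral_neg_log_lt_top⟩)
          hI.lt_top
        exact ENNReal.mul_lt_top ENNReal.ofReal_lt_top hI.lt_top

/-! ### Existence of minimizers -/

/-- The energy is lower semicontinuous: it is the supremum of the energies of the truncated
kernels, which are bounded and continuous. -/
theorem isClosed_setOf_mutualEnergy_le (hW : Continuous W) (c : ENNReal) :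
    IsClosed {ν : ProbabilityMeasure ℝ | mutualEnergy W B ν ν ≤ c} := by
  have hKc := continuous_shiftedKernel (B := B) hW
  have hcoe : ∀ (n : ℕ) (p : ℝ × ℝ),
      ((min (shiftedKernel W B p.1 p.2) n).toNNReal : ENNReal) =
        min (shiftedKernel W B p.1 p.2) n :=
    fun n p => ENNReal.coe_toNNReal (ne_top_of_le_ne_top (ENNReal.natCast_ne_top n)
      (min_le_right _ _))
  have hle : ∀ (n : ℕ) (p : ℝ × ℝ),
      (min (shiftedKernel W B p.1 p.2) n).toNNReal ≤ (n : NNReal) := by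
    intro n p
    rw [← ENNReal.coe_le_coe, hcoe]
    exact_mod_cast min_le_right _ _
  set k : ℕ → BoundedContinuousFunction (ℝ × ℝ) NNReal := fun n =>
    BoundedContinuousFunction.mkOfBound
      ⟨fun p => (min (shiftedKernel W B p.1 p.2) n).toNNReal,
        ENNReal.continuousOn_toNNReal.comp_continuous (hKc.min continuous_const) fun p =>
          ne_top_of_le_ne_top (ENNReal.natCast_ne_top n) (min_le_right _ _)⟩ n
      (fun p q => by
        rw [NNReal.dist_eq]
        have h1 := hle n p
        have h2 := hle n q
        have h1' : ((min (shiftedKernel W B p.1 p.2) n).toNNReal : ℝ) ≤ n := by exact_mod_cast h1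
        have h2' : ((min (shiftedKernel W B q.1 q.2) n).toNNReal : ℝ) ≤ n := by exact_mod_cast h2
        refine abs_sub_le_of_nonneg_of_le (NNReal.coe_nonneg _) ?_ (NNReal.coe_nonneg _) ?_
        · exact h1'
        · exact h2') with hk
  have hcont : ∀ n, Continuous fun ν : ProbabilityMeasure ℝ =>
      ∫⁻ p, (k n p : ENNReal) ∂((ν.prod ν : ProbabilityMeasure (ℝ × ℝ)) : Measure (ℝ × ℝ)) := by
    intro n
    refine continuous_iff_continuousAt.2 fun ν => ?_
    have h1 : Continuous fun ν : ProbabilityMeasure ℝ => ν.prod ν :=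
      ProbabilityMeasure.continuous_prod.comp (continuous_id.prodMk continuous_id)
    exact ProbabilityMeasure.tendsto_iff_forall_lintegral_tendsto.1 (h1.tendsto ν) (k n)
  have hset : {ν : ProbabilityMeasure ℝ | mutualEnergy W B ν ν ≤ c} =
      ⋂ n, {ν : ProbabilityMeasure ℝ | ∫⁻ p, (k n p : ENNReal)
        ∂((ν.prod ν : ProbabilityMeasure (ℝ × ℝ)) : Measure (ℝ × ℝ)) ≤ c} := by
    ext ν
    have h1 : mutualEnergy W B ν ν = ⨆ n, ∫⁻ p, (k n p : ENNReal)
        ∂((ν.prod ν : ProbabilityMeasure (ℝ × ℝ)) : Measure (ℝ × ℝ)) := by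
      rw [← lintegral_iSup]
      · rw [mutualEnergy]
        simp only [kernelPotential]
        rw [← lintegral_prod _ hKc.measurable.aemeasurable]
        refine lintegral_congr fun p => ?_
        have h2 : ∀ n, (k n p : ENNReal) = min (shiftedKernel W B p.1 p.2) n := fun n => hcoe n p
        simp only [h2]
        rw [← inf_iSup_eq, ENNReal.iSup_natCast, inf_top_eq]
      · exact fun n => (ENNReal.continuous_coe.comp (k n).continuous).measurable
      · intro i j hij p
        have h2 : ∀ n, (k n p : ENNReal) = min (shiftedKernel W B p.1 p.2) n := fun n => hcoe n p
        simp only [h2]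
        exact min_le_min_left _ (by exact_mod_cast hij)
    simp only [Set.mem_ofPred_eq, Set.mem_iInter, h1, iSup_le_iff]
  rw [hset]
  exact isClosed_iInter fun n => isClosed_le (hcont n) continuous_const

/-- Energy sublevel sets are tight, because the kernel is at least `log (1 + |x|)`. -/
theorem isCompact_setOf_mutualEnergy_le (hW : Continuous W) (hB : IsKernelShift W B) {c : ENNReal}
    (hc : c ≠ ⊤) : IsCompact {ν : ProbabilityMeasure ℝ | mutualEnergy W B ν ν ≤ c} := by
  rw [← (isClosed_setOf_mutualEnergy_le hW c).closure_eq]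
  refine isCompact_closure_of_isTightMeasureSet ?_
  rw [isTightMeasureSet_iff_exists_isCompact_measure_compl_le]
  intro ε hε
  have hlim : Tendsto (fun r : ℝ => c / ENNReal.ofReal (Real.log (1 + r))) atTop (𝓝 0) := by
    have h1 : Tendsto (fun r : ℝ => ENNReal.ofReal (Real.log (1 + r))) atTop (𝓝 ⊤) :=
      ENNReal.tendsto_ofReal_atTop.comp
        (Real.tendsto_log_atTop.comp (tendsto_atTop_add_const_left _ _ tendsto_id))
    simpa using ENNReal.Tendsto.const_div h1 (Or.inr hc)
  obtain ⟨r, hr, hr0⟩ := ((hlim.eventually_lt_const hε).and (eventually_gt_atTop 0)).exists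
  refine ⟨Metric.closedBall 0 r, isCompact_closedBall _ _, ?_⟩
  rintro _ ⟨ν, hν, rfl⟩
  have hν' : mutualEnergy W B ν ν ≤ c := hν
  have hlog : 0 < Real.log (1 + r) := Real.log_pos (by linarith)
  have h2 : ∫⁻ x, ENNReal.ofReal (Real.log (1 + |x|)) ∂(ν : Measure ℝ) ≤ c := by
    refine le_trans (lintegral_mono fun x => ?_) hν'
    calc ENNReal.ofReal (Real.log (1 + |x|))
        = ∫⁻ _, ENNReal.ofReal (Real.log (1 + |x|)) ∂(ν : Measure ℝ) := by simp
      _ ≤ _ := lintegral_mono fun y => hB.ofReal_log_le x y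
  refine le_trans ?_ hr.le
  have h3 : (Metric.closedBall (0 : ℝ) r)ᶜ ⊆ {x | ENNReal.ofReal (Real.log (1 + r)) ≤
      ENNReal.ofReal (Real.log (1 + |x|))} := by
    intro x hx
    rw [Set.mem_compl_iff, Metric.mem_closedBall, dist_zero_right, Real.norm_eq_abs, not_le] at hx
    exact ENNReal.ofReal_le_ofReal (Real.log_le_log (by linarith) (by linarith))
  refine (measure_mono h3).trans ((meas_ge_le_lintegral_div ?_
    (ENNReal.ofReal_pos.2 hlog).ne' ENNReal.ofReal_ne_top).trans (ENNReal.div_le_div_right h2 _))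
  refine (ENNReal.measurable_ofReal.comp (Real.measurable_log.comp ?_)).aemeasurable
  exact (by fun_prop : Continuous fun x : ℝ => 1 + |x|).measurable

theorem exists_isEnergyMinimizer {V : ℝ → ℝ} (hV : Continuous V) (hVs : IsSuperlogarithmic V)
    {s : ℝ} (hs : 0 < s) : ∃ μ, IsEnergyMinimizer V s μ := by
  obtain ⟨B, hB0, hB⟩ := hVs.exists_isKernelShift hs
  have hW : Continuous fun x => V x / s := hV.div_const s
  set W : ℝ → ℝ := fun x => V x / s
  let p₀ : ProbabilityMeasure ℝ := ⟨volume.restrict (Set.Icc 0 1), ⟨by simp⟩⟩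
  have hp₀ : mutualEnergy W B p₀ p₀ ≠ ⊤ := (mutualEnergy_volume_Icc_lt_top hW 0 1).ne
  have hlsc : LowerSemicontinuous fun ν : ProbabilityMeasure ℝ => mutualEnergy W B ν ν :=
    lowerSemicontinuous_iff_isClosed_preimage.2 fun c => isClosed_setOf_mutualEnergy_le hW c
  obtain ⟨ν₀, hν₀, hmin⟩ := (hlsc.lowerSemicontinuousOn
    {ν : ProbabilityMeasure ℝ | mutualEnergy W B ν ν ≤ mutualEnergy W B p₀ p₀}).exists_isMinOn
    ⟨p₀, le_refl (mutualEnergy W B p₀ p₀)⟩ (isCompact_setOf_mutualEnergy_le hW hB hp₀)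
  have hmin' : ∀ ν : ProbabilityMeasure ℝ, mutualEnergy W B ν₀ ν₀ ≤ mutualEnergy W B ν ν := by
    intro ν
    rcases le_total (mutualEnergy W B ν ν) (mutualEnergy W B p₀ p₀) with h | h
    · exact hmin h
    · exact le_trans hν₀ h
  refine ⟨ENNReal.ofReal s • (ν₀ : Measure ℝ),
    (isEnergyMinimizer_iff hV hs hB0 hB).2 ⟨by simp, ?_⟩⟩
  intro ν hν
  have hs0 : ENNReal.ofReal s ≠ 0 := (ENNReal.ofReal_pos.2 hs).ne'
  let ν' : ProbabilityMeasure ℝ := ⟨(ENNReal.ofReal s)⁻¹ • ν, ⟨by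
    rw [Measure.smul_apply, hν, smul_eq_mul, ENNReal.inv_mul_cancel hs0 ENNReal.ofReal_ne_top]⟩⟩
  have hν' : ν = ENNReal.ofReal s • (ν' : Measure ℝ) := by
    change ν = ENNReal.ofReal s • ((ENNReal.ofReal s)⁻¹ • ν)
    rw [smul_smul, ENNReal.mul_inv_cancel hs0 ENNReal.ofReal_ne_top, one_smul]
  rw [hν', mutualEnergy_smul_left, mutualEnergy_smul_left, mutualEnergy_smul_right hW,
    mutualEnergy_smul_right hW]
  gcongr
  exact hmin' ν'

/-! ### The variational inequality -/

/-- The first variation of the energy at a minimizer `μ`, in the direction of `η - μ`. -/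
theorem mutualEnergy_self_le_of_forall_le (hW : Continuous W) {m : ENNReal} {μ η : Measure ℝ}
    [IsFiniteMeasure μ] [IsFiniteMeasure η] (hμ : μ Set.univ = m) (hη : η Set.univ = m)
    (hmin : ∀ ν : Measure ℝ, ν Set.univ = m → mutualEnergy W B μ μ ≤ mutualEnergy W B ν ν)
    (hηt : mutualEnergy W B η η ≠ ⊤) :
    mutualEnergy W B μ μ ≤ mutualEnergy W B η μ := by
  by_contra! hlt
  have hA : mutualEnergy W B η μ ≠ ⊤ := ne_top_of_lt hlt
  have hI : mutualEnergy W B μ μ ≠ ⊤ := ne_top_of_le_ne_top hηt (hmin η hη)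
  have key : ∀ t : ℝ, 0 < t → t < 1 → (mutualEnergy W B μ μ).toReal ≤
      (1 - t) * ((1 - t) * (mutualEnergy W B μ μ).toReal + t * (mutualEnergy W B η μ).toReal) +
      t * ((1 - t) * (mutualEnergy W B η μ).toReal + t * (mutualEnergy W B η η).toReal) := by
    intro t ht0 ht1
    have h1 := hmin (ENNReal.ofReal (1 - t) • μ + ENNReal.ofReal t • η) (by
      rw [Measure.add_apply, Measure.smul_apply, Measure.smul_apply, hμ, hη, smul_eq_mul,
        smul_eq_mul, ← add_mul, ← ENNReal.ofReal_add (by linarith) ht0.le, sub_add_cancel,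
        ENNReal.ofReal_one, one_mul])
    have : IsFiniteMeasure (ENNReal.ofReal (1 - t) • μ) :=
      Measure.smul_finite μ ENNReal.ofReal_ne_top
    rw [mutualEnergy_add_left, mutualEnergy_smul_left, mutualEnergy_smul_left,
      mutualEnergy_add_right hW, mutualEnergy_add_right hW, mutualEnergy_smul_right hW,
      mutualEnergy_smul_right hW, mutualEnergy_smul_right hW, mutualEnergy_smul_right hW,
      mutualEnergy_comm hW μ η] at h1
    lift mutualEnergy W B μ μ to NNReal using hI with I
    lift mutualEnergy W B η μ to NNReal using hA with A
    lift mutualEnergy W B η η to NNReal using hηt with E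
    have h2 := ENNReal.toReal_mono (by finiteness) h1
    rw [ENNReal.toReal_add (by finiteness) (by finiteness), ENNReal.toReal_mul,
      ENNReal.toReal_mul, ENNReal.toReal_add (by finiteness) (by finiteness), ENNReal.toReal_mul,
      ENNReal.toReal_mul, ENNReal.toReal_add (by finiteness) (by finiteness), ENNReal.toReal_mul,
      ENNReal.toReal_mul, ENNReal.toReal_ofReal (by linarith), ENNReal.toReal_ofReal ht0.le] at h2
    exact h2
  have hAI := (ENNReal.toReal_lt_toReal hA hI).2 hlt
  set I := (mutualEnergy W B μ μ).toReal
  set A := (mutualEnergy W B η μ).toReal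
  set E := (mutualEnergy W B η η).toReal
  -- The energy at `t` is `I - 2 t (I - A) + t² (I - 2 A + E)`, less than `I` for small `t`.
  set N := |I - 2 * A + E| + (I - A) with hN
  have hN0 : 0 < N := by have := abs_nonneg (I - 2 * A + E); linarith
  have hq : (I - A) / N ≤ 1 := by
    rw [div_le_one hN0]
    linarith [abs_nonneg (I - 2 * A + E)]
  have hq0 : 0 < (I - A) / N := div_pos (by linarith) hN0
  have h1 := key ((I - A) / (2 * N)) (div_pos (by linarith) (by linarith)) (by
    rw [mul_comm, ← div_div]; linarith)
  set t := (I - A) / (2 * N) with ht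
  have ht0 : 0 < t := div_pos (by linarith) (by linarith)
  have h2 : t * N = (I - A) / 2 := by rw [ht]; field_simp
  have h3 : t * (I - 2 * A + E) ≤ t * N :=
    mul_le_mul_of_nonneg_left (by linarith [le_abs_self (I - 2 * A + E)]) ht0.le
  have h4 : t * (2 * (I - A) - t * (I - 2 * A + E)) ≤ 0 := by linarith
  nlinarith

/-- The Euler–Lagrange inequality almost everywhere for any measure `η` of finite energy: every
normalized restriction of `η` is an admissible direction. -/
theorem ae_div_le_kernelPotential (hW : Continuous W) {m : ENNReal} (hm0 : m ≠ 0) (hm : m ≠ ⊤)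
    {μ η : Measure ℝ} [IsFiniteMeasure μ] [IsFiniteMeasure η] (hμ : μ Set.univ = m)
    (hmin : ∀ ν : Measure ℝ, ν Set.univ = m → mutualEnergy W B μ μ ≤ mutualEnergy W B ν ν)
    (hηt : mutualEnergy W B η η ≠ ⊤) :
    ∀ᵐ x ∂η, mutualEnergy W B μ μ / m ≤ kernelPotential W B μ x := by
  refine ae_le_of_forall_setLIntegral_le_of_sigmaFinite measurable_const fun E hE _ => ?_
  rw [setLIntegral_const]
  rcases eq_or_ne (η E) 0 with h0 | h0
  · simp [h0]
  have hEt : η E ≠ ⊤ := measure_ne_top η E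
  have hq : m / η E ≠ ⊤ := ENNReal.div_ne_top hm h0
  have : IsFiniteMeasure ((m / η E) • η.restrict E) := Measure.smul_finite _ hq
  have h1 := mutualEnergy_self_le_of_forall_le hW (η := (m / η E) • η.restrict E) hμ (by
      rw [Measure.smul_apply, Measure.restrict_apply_univ, smul_eq_mul,
        ENNReal.div_mul_cancel h0 hEt])
    hmin (by
      rw [mutualEnergy_smul_left, mutualEnergy_smul_right hW]
      exact ENNReal.mul_ne_top hq (ENNReal.mul_ne_top hq (ne_top_of_le_ne_top hηt
        (mutualEnergy_mono Measure.restrict_le_self Measure.restrict_le_self))))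
  rw [mutualEnergy_smul_left] at h1
  calc mutualEnergy W B μ μ / m * η E
      ≤ m / η E * mutualEnergy W B (η.restrict E) μ / m * η E := by gcongr
    _ = mutualEnergy W B (η.restrict E) μ * ((m / m) * (η E / η E)) := by
        simp only [div_eq_mul_inv]
        ring
    _ = mutualEnergy W B (η.restrict E) μ := by
        rw [ENNReal.div_self hm0 hm, ENNReal.div_self h0 hEt, one_mul, mul_one]

theorem ae_kernelPotential_eq_div (hW : Continuous W) {m : ENNReal} (hm0 : m ≠ 0) (hm : m ≠ ⊤)
    {μ : Measure ℝ} [IsFiniteMeasure μ] (hμ : μ Set.univ = m)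
    (hmin : ∀ ν : Measure ℝ, ν Set.univ = m → mutualEnergy W B μ μ ≤ mutualEnergy W B ν ν)
    (hμt : mutualEnergy W B μ μ ≠ ⊤) :
    ∀ᵐ x ∂μ, kernelPotential W B μ x = mutualEnergy W B μ μ / m := by
  have h1 := ae_div_le_kernelPotential hW hm0 hm hμ hmin hμt
  have h2 : ∫⁻ _, mutualEnergy W B μ μ / m ∂μ = mutualEnergy W B μ μ := by
    rw [lintegral_const, hμ, ENNReal.div_mul_cancel hm0 hm]
  have h3 := ae_eq_of_ae_le_of_lintegral_le h1 (by rwa [h2])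
    (measurable_kernelPotential hW μ).aemeasurable (by rw [h2]; exact le_rfl)
  exact h3.mono fun x hx => hx.symm

/-- The average over `[-1, 1]` of the positive part of `-log |1 + τ v|`, up to the factor `2`. It
measures how much averaging over a short interval increases the logarithmic kernel. -/
noncomputable def averageDefect (τ : ℝ) : ENNReal :=
  ∫⁻ v in Set.Icc (-1 : ℝ) 1, ENNReal.ofReal (-Real.log |1 + τ * v|)

theorem measurable_averageDefect : Measurable averageDefect := by
  have h : Measurable fun p : ℝ × ℝ => ENNReal.ofReal (-Real.log |1 + p.1 * p.2|) := by
    refine ENNReal.measurable_ofReal.comp (Real.measurable_log.comp ?_).neg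
    exact (by fun_prop : Continuous fun p : ℝ × ℝ => |1 + p.1 * p.2|).measurable
  exact h.lintegral_prod_right'

theorem averageDefect_le_of_abs_le {τ : ℝ} (hτ : |τ| ≤ 1 / 2) :
    averageDefect τ ≤ ENNReal.ofReal (2 * |τ|) * 2 := by
  have h1 : averageDefect τ ≤ ∫⁻ _ in Set.Icc (-1 : ℝ) 1, ENNReal.ofReal (2 * |τ|) := by
    refine setLIntegral_mono measurable_const fun v hv => ENNReal.ofReal_le_ofReal ?_
    have h2 : |τ * v| ≤ |τ| := by
      rw [abs_mul]
      exact mul_le_of_le_one_right (abs_nonneg τ) (abs_le.2 hv)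
    have h3 := abs_le.1 h2
    have h4 : 1 / 2 ≤ 1 + τ * v := by linarith
    have h5 := Real.one_sub_inv_le_log_of_pos (by linarith : 0 < 1 + τ * v)
    rw [abs_of_pos (by linarith)]
    have h6 : (1 + τ * v)⁻¹ - 1 ≤ 2 * |τ| := by
      rw [sub_le_iff_le_add, inv_le_iff_one_le_mul₀ (by linarith)]
      nlinarith [abs_nonneg τ]
    linarith
  refine h1.trans_eq ?_
  rw [setLIntegral_const, Real.volume_Icc]
  norm_num

/-- For `|τ| > 1 / 2` the zero of `1 + τ v` may lie in the interval, but `-log |1 + τ v|` is then at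
most `log 2` plus a translate of the locally integrable function `-log |v|`. -/
theorem exists_averageDefect_le : ∃ D : ENNReal, D ≠ ⊤ ∧ ∀ τ, averageDefect τ ≤ D := by
  refine ⟨ENNReal.ofReal (Real.log 2) * 2 + (∫⁻ x : ℝ, ENNReal.ofReal (-Real.log |x|)) +
    2, ?_, fun τ => ?_⟩
  · exact ENNReal.add_ne_top.2 ⟨ENNReal.add_ne_top.2 ⟨by finiteness,
      lintegral_neg_log_lt_top.ne⟩, ENNReal.ofNat_ne_top⟩
  rcases le_or_gt |τ| (1 / 2) with hτ | hτ
  · refine (averageDefect_le_of_abs_le hτ).trans (le_trans ?_ le_add_self)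
    calc ENNReal.ofReal (2 * |τ|) * 2 ≤ ENNReal.ofReal 1 * 2 := by gcongr; linarith
      _ = 2 := by simp
  · have hτ0 : τ ≠ 0 := by rintro rfl; norm_num at hτ
    refine le_trans ?_ le_self_add
    calc averageDefect τ
        ≤ ∫⁻ v in Set.Icc (-1 : ℝ) 1,
            (ENNReal.ofReal (Real.log 2) + ENNReal.ofReal (-Real.log |v - -τ⁻¹|)) := by
          refine lintegral_mono fun v => le_trans (ENNReal.ofReal_le_ofReal ?_)
            ENNReal.ofReal_add_le
          have h1 : 1 + τ * v = τ * (v - -τ⁻¹) := by field_simp; ring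
          have h2 : 0 ≤ Real.log 2 := Real.log_nonneg one_le_two
          rcases eq_or_ne (v - -τ⁻¹) 0 with h0 | h0
          · rw [h1, h0]
            simpa using h2
          · have h3 : Real.log (1 / 2) ≤ Real.log |τ| := Real.log_le_log (by norm_num) hτ.le
            rw [one_div, Real.log_inv] at h3
            rw [h1, abs_mul, Real.log_mul (abs_ne_zero.2 hτ0) (abs_ne_zero.2 h0)]
            linarith
      _ ≤ ENNReal.ofReal (Real.log 2) * 2 + ∫⁻ x : ℝ, ENNReal.ofReal (-Real.log |x|) := by
          rw [lintegral_add_left measurable_const, setLIntegral_const, Real.volume_Icc,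
            ← lintegral_neg_log_sub (-τ⁻¹)]
          gcongr
          · norm_num
          · exact Measure.restrict_le_self

theorem ae_add_mul_mem {p : ℝ → Prop} (hp : ∀ᵐ x, p x) (x₀ : ℝ) {ε : ℝ} (hε : ε ≠ 0) :
    ∀ᵐ v : ℝ, p (x₀ + ε * v) := by
  have h1 : ∀ᵐ x : ℝ, p (x₀ + x) := (quasiMeasurePreserving_add_left volume x₀).ae hp
  have h2 : Measure.QuasiMeasurePreserving (fun v : ℝ => ε * v) volume volume := by
    refine ⟨measurable_const_mul ε, Measure.AbsolutelyContinuous.mk fun N hN hN0 => ?_⟩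
    rw [Measure.map_apply (measurable_const_mul ε) hN, Real.volume_preimage_mul_left hε, hN0,
      mul_zero]
  exact h2.ae h1

theorem lintegral_shiftedKernel_add_mul_le {x₀ y ε ω : ℝ} (hε : 0 < ε)
    (hω : ∀ v ∈ Set.Icc (-1 : ℝ) 1, W (x₀ + ε * v) ≤ W x₀ + ω) (hy : y ≠ x₀) :
    ∫⁻ v in Set.Icc (-1 : ℝ) 1, shiftedKernel W B (x₀ + ε * v) y ≤
      shiftedKernel W B x₀ y * 2 + ENNReal.ofReal ω * 2 + averageDefect (ε / (x₀ - y)) := by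
  have hd : x₀ - y ≠ 0 := sub_ne_zero.2 hy.symm
  have hne : ∀ᵐ v : ℝ, x₀ + ε * v ≠ y :=
    ae_add_mul_mem (p := fun x => x ≠ y) (compl_mem_ae_iff.2 (measure_singleton y)) x₀ hε.ne'
  have hle : ∫⁻ v in Set.Icc (-1 : ℝ) 1, shiftedKernel W B (x₀ + ε * v) y ≤
      ∫⁻ v in Set.Icc (-1 : ℝ) 1, ((shiftedKernel W B x₀ y + ENNReal.ofReal ω) +
        ENNReal.ofReal (-Real.log |1 + ε / (x₀ - y) * v|)) := by
    refine lintegral_mono_ae ?_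
    filter_upwards [ae_restrict_mem measurableSet_Icc, ae_restrict_of_ae hne] with v hv hvy
    have h1 : x₀ + ε * v - y = (x₀ - y) * (1 + ε / (x₀ - y) * v) := by
      field_simp
      ring
    have h2 : 1 + ε / (x₀ - y) * v ≠ 0 := by
      intro h0
      rw [h0, mul_zero] at h1
      exact hvy (sub_eq_zero.1 h1)
    have h3 : Real.log |x₀ + ε * v - y| =
        Real.log |x₀ - y| + Real.log |1 + ε / (x₀ - y) * v| := by
      rw [h1, abs_mul, Real.log_mul (abs_ne_zero.2 hd) (abs_ne_zero.2 h2)]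
    rw [shiftedKernel_of_ne hvy, shiftedKernel_of_ne hy.symm, h3]
    calc _ ≤ ENNReal.ofReal ((W x₀ + W y + B - Real.log |x₀ - y|) + ω +
            -Real.log |1 + ε / (x₀ - y) * v|) :=
          ENNReal.ofReal_le_ofReal (by linarith [hω v hv])
      _ ≤ _ := ENNReal.ofReal_add_le
      _ ≤ _ := by gcongr; exact ENNReal.ofReal_add_le
  rw [lintegral_add_left measurable_const, setLIntegral_const, Real.volume_Icc] at hle
  refine hle.trans_eq ?_
  rw [averageDefect, add_mul]
  norm_num

/-- Averaging the kernel potential over the interval of radius `ε` around `x₀` increases it by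
at most the oscillation of the external field and the averaged defect of the logarithm. -/
theorem lintegral_kernelPotential_add_mul_le (hW : Continuous W) {μ : Measure ℝ}
    [IsFiniteMeasure μ] {x₀ ε ω : ℝ} (hε : 0 < ε)
    (hω : ∀ v ∈ Set.Icc (-1 : ℝ) 1, W (x₀ + ε * v) ≤ W x₀ + ω) (hx₀ : ∀ᵐ y ∂μ, y ≠ x₀) :
    ∫⁻ v in Set.Icc (-1 : ℝ) 1, kernelPotential W B μ (x₀ + ε * v) ≤
      kernelPotential W B μ x₀ * 2 + ENNReal.ofReal ω * 2 * μ Set.univ +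
        ∫⁻ y, averageDefect (ε / (x₀ - y)) ∂μ := by
  have hm : Measurable fun p : ℝ × ℝ => shiftedKernel W B (x₀ + ε * p.1) p.2 :=
    measurable_shiftedKernel hW (by fun_prop) measurable_snd
  have hmy : Measurable fun y => shiftedKernel W B x₀ y :=
    measurable_shiftedKernel hW measurable_const measurable_id
  have hswap : ∫⁻ v in Set.Icc (-1 : ℝ) 1, kernelPotential W B μ (x₀ + ε * v) =
      ∫⁻ y, (∫⁻ v in Set.Icc (-1 : ℝ) 1, shiftedKernel W B (x₀ + ε * v) y) ∂μ := by
    simp only [kernelPotential]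
    exact lintegral_lintegral_swap (f := fun v y => shiftedKernel W B (x₀ + ε * v) y)
      hm.aemeasurable
  have hpt : ∀ᵐ y ∂μ, ∫⁻ v in Set.Icc (-1 : ℝ) 1, shiftedKernel W B (x₀ + ε * v) y ≤
      shiftedKernel W B x₀ y * 2 + ENNReal.ofReal ω * 2 + averageDefect (ε / (x₀ - y)) := by
    filter_upwards [hx₀] with y hy
    exact lintegral_shiftedKernel_add_mul_le hε hω hy
  have hsum : Measurable fun y => shiftedKernel W B x₀ y * 2 + ENNReal.ofReal ω * 2 :=
    (hmy.mul_const _).add_const _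
  rw [hswap]
  refine (lintegral_mono_ae hpt).trans_eq ?_
  rw [lintegral_add_left hsum, lintegral_add_right _ measurable_const,
    lintegral_mul_const _ hmy, lintegral_const, kernelPotential]

theorem tendsto_lintegral_averageDefect (μ : Measure ℝ) [IsFiniteMeasure μ] (x₀ : ℝ) :
    Tendsto (fun n : ℕ => ∫⁻ y, averageDefect (1 / ((n : ℝ) + 1) / (x₀ - y)) ∂μ) atTop
      (𝓝 0) := by
  obtain ⟨D, hD, hDle⟩ := exists_averageDefect_le
  rw [← lintegral_zero (μ := μ)]
  refine tendsto_lintegral_of_dominated_convergence (fun _ => D) (fun n => ?_)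
    (fun n => .of_forall fun y => hDle _) ?_ ?_
  · exact measurable_averageDefect.comp (by fun_prop)
  · rw [lintegral_const]
    exact ENNReal.mul_ne_top hD (measure_ne_top _ _)
  · refine .of_forall fun y => ?_
    have h1 : Tendsto (fun n : ℕ => 1 / ((n : ℝ) + 1) / (x₀ - y)) atTop (𝓝 0) := by
      simpa using tendsto_one_div_add_atTop_nhds_zero_nat.div_const (x₀ - y)
    have h2 := h1.abs
    rw [abs_zero] at h2
    have h3 : Tendsto (fun n : ℕ => ENNReal.ofReal (2 * |1 / ((n : ℝ) + 1) / (x₀ - y)|) * 2) atTop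
        (𝓝 0) := by
      have h4 := ENNReal.tendsto_ofReal (h2.const_mul 2)
      rw [mul_zero, ENNReal.ofReal_zero] at h4
      simpa using ENNReal.Tendsto.mul_const h4 (Or.inr (ENNReal.ofNat_ne_top (n := 2)))
    refine tendsto_of_tendsto_of_tendsto_of_le_of_le' tendsto_const_nhds h3
      (.of_forall fun _ => zero_le) ?_
    filter_upwards [h2.eventually_le_const (by norm_num : (0 : ℝ) < 1 / 2)] with n hn
    exact averageDefect_le_of_abs_le hn

/-- The Euler–Lagrange inequality holds at every point, not merely almost everywhere: normalized
Lebesgue measure on short intervals around `x₀` is an admissible direction, and the averages of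
the kernel potential over these intervals are asymptotically at most its value at `x₀`. -/
theorem div_le_kernelPotential (hW : Continuous W) {m : ENNReal} (hm0 : m ≠ 0) (hm : m ≠ ⊤)
    {μ : Measure ℝ} [IsFiniteMeasure μ] (hμ : μ Set.univ = m)
    (hmin : ∀ ν : Measure ℝ, ν Set.univ = m → mutualEnergy W B μ μ ≤ mutualEnergy W B ν ν)
    (x₀ : ℝ) : mutualEnergy W B μ μ / m ≤ kernelPotential W B μ x₀ := by
  rcases eq_or_ne (kernelPotential W B μ x₀) ⊤ with htop | htop
  · rw [htop]
    exact le_top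
  set c := mutualEnergy W B μ μ / m with hc
  have hx₀ : ∀ᵐ y ∂μ, y ≠ x₀ := by
    have hmy : Measurable fun y => shiftedKernel W B x₀ y :=
      measurable_shiftedKernel hW measurable_const measurable_id
    filter_upwards [ae_lt_top hmy htop] with y hy
    rintro rfl
    rw [shiftedKernel_self] at hy
    exact lt_irrefl _ hy
  have hae := ae_div_le_kernelPotential hW hm0 hm hμ hmin
    (mutualEnergy_volume_Icc_lt_top hW (x₀ - 1) (x₀ + 1)).ne
  rw [ae_restrict_iff' measurableSet_Icc] at hae
  have hε : ∀ n : ℕ, (0 : ℝ) < 1 / ((n : ℝ) + 1) := fun n => by positivity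
  have hε1 : ∀ n : ℕ, 1 / ((n : ℝ) + 1) ≤ (1 : ℝ) := fun n => by
    rw [div_le_one (by positivity)]
    linarith [Nat.cast_nonneg (α := ℝ) n]
  have hlow : ∀ n : ℕ, c * 2 ≤
      ∫⁻ v in Set.Icc (-1 : ℝ) 1, kernelPotential W B μ (x₀ + 1 / ((n : ℝ) + 1) * v) := by
    intro n
    have hvol : volume (Set.Icc (-1 : ℝ) 1) = 2 := by rw [Real.volume_Icc]; norm_num
    rw [← hvol, ← setLIntegral_const]
    refine lintegral_mono_ae ?_
    filter_upwards [ae_restrict_mem measurableSet_Icc,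
      ae_restrict_of_ae (ae_add_mul_mem hae x₀ (hε n).ne')] with v hv hvc
    refine hvc ?_
    have h1 : |1 / ((n : ℝ) + 1) * v| ≤ 1 := by
      rw [abs_mul, abs_of_pos (hε n)]
      exact mul_le_one₀ (hε1 n) (abs_nonneg v) (abs_le.2 hv)
    have h2 := abs_le.1 h1
    exact ⟨by linarith, by linarith⟩
  have hup : ∀ ω > 0, c * 2 ≤ kernelPotential W B μ x₀ * 2 + ENNReal.ofReal ω * 2 * m := by
    intro ω hω
    obtain ⟨d, hd, hdW⟩ := Metric.continuousAt_iff.1 hW.continuousAt ω hω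
    have hlim : Tendsto (fun n : ℕ => kernelPotential W B μ x₀ * 2 + ENNReal.ofReal ω * 2 * m +
        ∫⁻ y, averageDefect (1 / ((n : ℝ) + 1) / (x₀ - y)) ∂μ) atTop
        (𝓝 (kernelPotential W B μ x₀ * 2 + ENNReal.ofReal ω * 2 * m)) := by
      simpa using (tendsto_lintegral_averageDefect μ x₀).const_add
        (kernelPotential W B μ x₀ * 2 + ENNReal.ofReal ω * 2 * m)
    refine ge_of_tendsto hlim ?_
    filter_upwards [tendsto_one_div_add_atTop_nhds_zero_nat.eventually_lt_const hd] with n hn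
    refine (hlow n).trans ?_
    rw [← hμ]
    refine lintegral_kernelPotential_add_mul_le hW (hε n) (fun v hv => ?_) hx₀
    have h1 := hdW (x := x₀ + 1 / ((n : ℝ) + 1) * v) (by
      rw [Real.dist_eq, add_sub_cancel_left, abs_mul, abs_of_pos (hε n)]
      exact (mul_le_of_le_one_right (hε n).le (abs_le.2 hv)).trans_lt hn)
    rw [Real.dist_eq] at h1
    linarith [(abs_lt.1 h1).2]
  have hlim : Tendsto (fun n : ℕ => kernelPotential W B μ x₀ * 2 +
      ENNReal.ofReal (1 / ((n : ℝ) + 1)) * 2 * m) atTop (𝓝 (kernelPotential W B μ x₀ * 2)) := by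
    have h1 := ENNReal.tendsto_ofReal tendsto_one_div_add_atTop_nhds_zero_nat
    rw [ENNReal.ofReal_zero] at h1
    have h2 := ENNReal.Tendsto.mul_const
      (ENNReal.Tendsto.mul_const h1 (Or.inr (ENNReal.ofNat_ne_top (n := 2)))) (Or.inr hm)
    simpa using h2.const_add (kernelPotential W B μ x₀ * 2)
  have h3 := ge_of_tendsto' hlim fun n => hup _ (hε n)
  exact (ENNReal.mul_le_mul_iff_left two_ne_zero ENNReal.ofNat_ne_top).1 h3

/-! ### Equilibrium pairs -/

/-- A compactly supported measure `μ` of mass `s` with continuous potential, together with a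
constant `F`, satisfying the Euler–Lagrange conditions in the external potential `V`. -/
structure IsEquilibriumPair (V : ℝ → ℝ) (s : ℝ) (μ : Measure ℝ) (F : ℝ) : Prop where
  mass : μ Set.univ = ENNReal.ofReal s
  hasContinuousPotential : ∃ R, HasContinuousPotential μ R
  ge : ∀ x : ℝ, F - V x ≤ linePotential μ x
  ae_eq : ∀ᵐ x : ℝ ∂μ, linePotential μ x = F - V x

theorem norm_ofReal_sub_ofReal (x t : ℝ) : ‖(x : ℂ) - t‖ = |x - t| := by
  rw [← Complex.ofReal_sub, Complex.norm_real, Real.norm_eq_abs]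

/-- Lower semicontinuity of the kernel potential, from Fatou's lemma. -/
theorem isClosed_setOf_kernelPotential_le (hW : Continuous W) (μ : Measure ℝ) (c : ENNReal) :
    IsClosed {x | kernelPotential W B μ x ≤ c} := by
  refine IsSeqClosed.isClosed fun u x hu hux => ?_
  have hlim : ∀ y, liminf (fun n => shiftedKernel W B (u n) y) atTop = shiftedKernel W B x y :=
    fun y => (((continuous_shiftedKernel hW).tendsto (x, y)).comp
      (hux.prodMk_nhds tendsto_const_nhds)).liminf_eq
  have h1 := lintegral_liminf_le (μ := μ) (u := atTop)
    (f := fun n y => shiftedKernel W B (u n) y) fun n =>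
    measurable_shiftedKernel hW measurable_const measurable_id
  simp only [hlim] at h1
  exact h1.trans ((liminf_le_liminf (.of_forall hu)).trans_eq (liminf_const c))

theorem IsKernelShift.ofReal_log_mul_le_kernelPotential (hB : IsKernelShift W B) (μ : Measure ℝ)
    (x : ℝ) : ENNReal.ofReal (Real.log (1 + |x|)) * μ Set.univ ≤ kernelPotential W B μ x := by
  rw [← lintegral_const]
  exact lintegral_mono fun y => hB.ofReal_log_le x y

theorem ae_ne_of_kernelPotential_ne_top (hW : Continuous W) {μ : Measure ℝ} {x : ℝ}
    (hx : kernelPotential W B μ x ≠ ⊤) : ∀ᵐ y ∂μ, y ≠ x := by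
  have hmy : Measurable fun y => shiftedKernel W B x y :=
    measurable_shiftedKernel hW measurable_const measurable_id
  filter_upwards [ae_lt_top hmy hx] with y hy
  rintro rfl
  rw [shiftedKernel_self] at hy
  exact lt_irrefl _ hy

theorem kernelPotential_eq_lintegral_ofReal {μ : Measure ℝ} {x : ℝ} (hx : ∀ᵐ y ∂μ, y ≠ x) :
    kernelPotential W B μ x =
      ∫⁻ y, ENNReal.ofReal (W x + W y + B - Real.log ‖(x : ℂ) - y‖) ∂μ := by
  refine lintegral_congr_ae ?_
  filter_upwards [hx] with y hy
  rw [shiftedKernel_of_ne hy.symm, norm_ofReal_sub_ofReal]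

theorem IsKernelShift.integrand_nonneg (hB : IsKernelShift W B) (x y : ℝ) :
    0 ≤ W x + W y + B - Real.log ‖(x : ℂ) - y‖ := by
  rw [norm_ofReal_sub_ofReal]
  refine le_trans (add_nonneg ?_ ?_) (hB.log_add_log_le x y) <;>
    exact Real.log_nonneg (by linarith [abs_nonneg x, abs_nonneg y])

theorem integrable_log_of_kernelPotential_ne_top (hW : Continuous W) (hB : IsKernelShift W B)
    {μ : Measure ℝ} [IsFiniteMeasure μ] (hWi : Integrable W μ) {x : ℝ}
    (hx : kernelPotential W B μ x ≠ ⊤) :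
    Integrable (fun y : ℝ => Real.log ‖(x : ℂ) - y‖) μ := by
  have hlog : Measurable fun y : ℝ => Real.log ‖(x : ℂ) - y‖ :=
    measurable_log_norm_sub.comp (measurable_const.prodMk measurable_id)
  have hm : Measurable fun y : ℝ => W x + W y + B - Real.log ‖(x : ℂ) - y‖ :=
    ((hW.measurable.const_add _).add_const _).sub hlog
  rw [kernelPotential_eq_lintegral_ofReal (ae_ne_of_kernelPotential_ne_top hW hx),
    lintegral_ofReal_ne_top_iff_integrable hm.aestronglyMeasurable
      (.of_forall fun y => hB.integrand_nonneg x y)] at hx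
  refine ((((integrable_const (W x)).add hWi).add (integrable_const B)).sub hx).congr
    (.of_forall fun y => ?_)
  simp

theorem kernelPotential_eq_ofReal (hB : IsKernelShift W B) {μ : Measure ℝ} [IsFiniteMeasure μ]
    (hWi : Integrable W μ) {x : ℝ} (hx : ∀ᵐ y ∂μ, y ≠ x)
    (hi : Integrable (fun y : ℝ => Real.log ‖(x : ℂ) - y‖) μ) :
    kernelPotential W B μ x = ENNReal.ofReal (μ.real Set.univ * W x + ∫ y, W y ∂μ +
      μ.real Set.univ * B + linePotential μ x) ∧
    0 ≤ μ.real Set.univ * W x + ∫ y, W y ∂μ + μ.real Set.univ * B + linePotential μ x := by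
  have h0 : Integrable (fun y : ℝ => W x + W y) μ := (integrable_const (W x)).add hWi
  have h1 : Integrable (fun y : ℝ => W x + W y + B) μ := h0.add (integrable_const B)
  have h2 : Integrable (fun y : ℝ => W x + W y + B - Real.log ‖(x : ℂ) - y‖) μ := h1.sub hi
  have h3 : ∫ y, (W x + W y + B - Real.log ‖(x : ℂ) - y‖) ∂μ =
      μ.real Set.univ * W x + ∫ y, W y ∂μ + μ.real Set.univ * B + linePotential μ x := by
    rw [integral_sub h1 hi, integral_add h0 (integrable_const B),
      integral_add (integrable_const (W x)) hWi, integral_const, integral_const, linePotential,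
      integral_neg, smul_eq_mul, smul_eq_mul, sub_eq_add_neg]
  rw [← h3]
  refine ⟨?_, integral_nonneg fun y => hB.integrand_nonneg x y⟩
  rw [kernelPotential_eq_lintegral_ofReal hx, ofReal_integral_eq_lintegral_ofReal h2
    (.of_forall fun y => hB.integrand_nonneg x y)]

/-- Minimizers satisfy the Euler–Lagrange conditions with a real constant. The lower
semicontinuous kernel potential takes its minimal value on the whole support, so the potential
is continuous there, and therefore everywhere. -/
theorem IsEnergyMinimizer.exists_isEquilibriumPair {V : ℝ → ℝ} (hV : Continuous V)
    (hVs : IsSuperlogarithmic V) {s : ℝ} (hs : 0 < s) {μ : Measure ℝ}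
    (hμ : IsEnergyMinimizer V s μ) : ∃ F, IsEquilibriumPair V s μ F := by
  obtain ⟨B, hB0, hB⟩ := hVs.exists_isKernelShift hs
  have hW : Continuous fun x => V x / s := hV.div_const s
  obtain ⟨hmass, hmin⟩ := (isEnergyMinimizer_iff hV hs hB0 hB).1 hμ
  have hsW : ∀ x, s * (V x / s) = V x := fun x => mul_div_cancel₀ _ hs.ne'
  set W : ℝ → ℝ := fun x => V x / s with hWdef
  set m := ENNReal.ofReal s with hm
  have hm0 : m ≠ 0 := (ENNReal.ofReal_pos.2 hs).ne'
  have hmt : m ≠ ⊤ := ENNReal.ofReal_ne_top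
  have hfin : IsFiniteMeasure μ := ⟨by rw [hmass]; exact hmt.lt_top⟩
  have hreal : μ.real Set.univ = s := by rw [measureReal_def, hmass, ENNReal.toReal_ofReal hs.le]
  have hIt : mutualEnergy W B μ μ ≠ ⊤ := by
    refine ne_top_of_le_ne_top ?_ (hmin (m • volume.restrict (Set.Icc 0 1)) (by simp))
    rw [mutualEnergy_smul_left, mutualEnergy_smul_right hW]
    exact ENNReal.mul_ne_top hmt (ENNReal.mul_ne_top hmt
      (mutualEnergy_volume_Icc_lt_top hW 0 1).ne)
  have hae := ae_kernelPotential_eq_div hW hm0 hmt hmass hmin hIt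
  have hge := div_le_kernelPotential hW hm0 hmt hmass hmin
  set c := mutualEnergy W B μ μ / m with hc
  have hct : c ≠ ⊤ := ENNReal.div_ne_top hIt hm0
  -- Almost everywhere `m log (1 + |x|) ≤ c`, so `μ` lives on `[-R, R]`.
  set R := Real.exp (c / m).toReal with hRdef
  have hR : 0 < R := Real.exp_pos _
  have hSR : μ.support ⊆ Metric.closedBall 0 R := by
    refine Measure.support_subset_of_isClosed Metric.isClosed_closedBall ?_
    filter_upwards [hae] with x hx
    have h1 := hB.ofReal_log_mul_le_kernelPotential μ x
    rw [hx, hmass] at h1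
    have h2 := (ENNReal.le_div_iff_mul_le (Or.inl hm0) (Or.inl hmt)).2 h1
    have h3 := (ENNReal.ofReal_le_iff_le_toReal (ENNReal.div_ne_top hct hm0)).1 h2
    have h4 := (Real.log_le_iff_le_exp (by positivity)).1 h3
    rw [Metric.mem_closedBall, dist_zero_right, Real.norm_eq_abs]
    linarith
  have hS : IsCompact μ.support :=
    (isCompact_closedBall 0 R).of_isClosed_subset Measure.isClosed_support hSR
  have hμS : ∀ᵐ x ∂μ, x ∈ μ.support := Measure.support_mem_ae
  have hle : ∀ x ∈ μ.support, kernelPotential W B μ x ≤ c :=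
    Measure.support_subset_of_isClosed (isClosed_setOf_kernelPotential_le hW μ c)
      (hae.mono fun x hx => hx.le)
  have hne : ∀ x, ∀ᵐ y ∂μ, y ≠ x := by
    intro x
    by_cases hx : x ∈ μ.support
    · exact ae_ne_of_kernelPotential_ne_top hW (ne_top_of_le_ne_top hct (hle x hx))
    · filter_upwards [hμS] with y hy
      rintro rfl
      exact hx hy
  have hatom : NullSingletonClass μ := ⟨fun x => by simpa [ae_iff] using hne x⟩
  have hWi : Integrable W μ := by
    have := hW.continuousOn.integrableOn_compact (μ := μ) hS
    rwa [IntegrableOn, Measure.restrict_eq_self_of_ae_mem hμS] at this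
  have hlogi : ∀ x ∈ μ.support, Integrable (fun y : ℝ => Real.log ‖(x : ℂ) - y‖) μ := fun x hx =>
    integrable_log_of_kernelPotential_ne_top hW hB hWi (ne_top_of_le_ne_top hct (hle x hx))
  set F := c.toReal - ∫ y, W y ∂μ - s * B with hF
  have heq : ∀ x ∈ μ.support, linePotential μ x = F - V x := by
    intro x hx
    obtain ⟨h1, h2⟩ := kernelPotential_eq_ofReal hB hWi (hne x) (hlogi x hx)
    have h3 : c = kernelPotential W B μ x := le_antisymm (hge x) (hle x hx)
    rw [hF, h3, h1, ENNReal.toReal_ofReal h2, hreal, hsW]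
    ring
  have hcont : ContinuousOn (fun x : ℝ => linePotential μ x) μ.support :=
    (continuous_const.sub hV).continuousOn.congr heq
  have hμ0 : μ ≠ 0 := by
    rintro rfl
    exact hm0 (by simpa using hmass.symm)
  have hP := hasContinuousPotential_of_continuousOn hS (Measure.nonempty_support hμ0) hμS hR
    (fun t ht => by simpa using hSR ht) hlogi hcont
  refine ⟨F, hmass, ⟨R, hP⟩, fun x => ?_, hμS.mono heq⟩
  obtain ⟨h1, h2⟩ := kernelPotential_eq_ofReal hB hWi (hne x) (hP.integrable x)
  have h3 := hge x
  rw [h1] at h3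
  have h4 := ENNReal.toReal_mono ENNReal.ofReal_ne_top h3
  rw [ENNReal.toReal_ofReal h2, hreal, hsW] at h4
  linarith

end

section

variable {V : ℝ → ℝ} {μ ν : Measure ℝ} {R s : ℝ}

/-! ### Comparison and uniqueness of equilibrium pairs -/

theorem HasContinuousPotential.of_ae_abs_le {R' : ℝ} (h : HasContinuousPotential μ R)
    (hR' : 0 < R') (hle : ∀ᵐ t ∂μ, |t| ≤ R') : HasContinuousPotential μ R' :=
  ⟨h.finite, h.noAtoms, hR', hle, h.integrable, h.continuous⟩

theorem IsEquilibriumPair.real_mass {F : ℝ} (h : IsEquilibriumPair V s μ F) (hs : 0 < s) :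
    μ.real Set.univ = s := by
  rw [measureReal_def, h.mass, ENNReal.toReal_ofReal hs.le]

/-- The potential, normalized to lie above `-V` with contact on its measure, decreases as the mass
grows: on the contact set of the larger measure the inequality holds by the Euler–Lagrange
conditions, and the domination principle extends it to the plane. -/
theorem IsEquilibriumPair.sub_le_sub {s' F F' : ℝ} {μ' : Measure ℝ} (hV : Continuous V)
    (h : IsEquilibriumPair V s μ F) (h' : IsEquilibriumPair V s' μ' F') (hs : 0 < s)
    (hss' : s ≤ s') (z : ℂ) : linePotential μ' z - F' ≤ linePotential μ z - F := by
  obtain ⟨R, hR⟩ := h.hasContinuousPotential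
  obtain ⟨R', hR'⟩ := h'.hasContinuousPotential
  have hs' : 0 < s' := hs.trans_le hss'
  have hcl : IsClosed {x : ℝ | linePotential μ' x = F' - V x} :=
    isClosed_eq (hR'.continuous.comp Complex.continuous_ofReal) (continuous_const.sub hV)
  have hA : IsCompact ((↑) '' ({x : ℝ | linePotential μ' x = F' - V x} ∩
      Metric.closedBall 0 R') : Set ℂ) :=
    ((isCompact_closedBall (0 : ℝ) R').inter_left hcl).image Complex.continuous_ofReal
  have key := hR'.le_of_le_on hR hA ?_ ?_ ?_ (c := F' - F) ?_ z
  · linarith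
  · filter_upwards [h'.ae_eq, hR'.ae_abs_le] with t ht htR
    exact ⟨t, ⟨ht, by simpa using htR⟩, rfl⟩
  · rwa [h.real_mass hs, h'.real_mass hs']
  · rwa [h'.real_mass hs']
  · rintro _ ⟨x, ⟨hx, -⟩, rfl⟩
    have h1 := h.ge x
    have h2 : linePotential μ' x = F' - V x := hx
    linarith

/-- The Euler–Lagrange constant depends only on `V` and the mass. -/
theorem IsEquilibriumPair.constant_unique {F F' : ℝ} {μ' : Measure ℝ} (hV : Continuous V)
    (h : IsEquilibriumPair V s μ F) (h' : IsEquilibriumPair V s μ' F') (hs : 0 < s) :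
    F = F' := by
  obtain ⟨R, hR⟩ := h.hasContinuousPotential
  obtain ⟨R', hR'⟩ := h'.hasContinuousPotential
  have hmax : 0 < max R R' := lt_max_of_lt_left hR.radius_pos
  replace hR := hR.of_ae_abs_le hmax (hR.ae_abs_le.mono fun t ht => ht.trans (le_max_left _ _))
  replace hR' := hR'.of_ae_abs_le hmax (hR'.ae_abs_le.mono fun t ht => ht.trans (le_max_right _ _))
  have h0 : (fun z => 1 * linePotential μ z - linePotential μ' z - (F - F')) = fun _ => 0 := by
    funext z
    linarith [h.sub_le_sub hV h' hs le_rfl z, h'.sub_le_sub hV h hs le_rfl z]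
  -- Over a circle enclosing both measures the two potentials have the same average.
  have h1 := circleAverage_mul_sub_sub hR.continuous hR'.continuous 1 (F - F') 0 (max R R')
  rw [h0, Real.circleAverage_const, hR.circleAverage_zero_eq, hR'.circleAverage_zero_eq,
    h.real_mass hs, h'.real_mass hs] at h1
  linarith

/-! ### Rescaling -/

theorem log_norm_sub_mul_ae_eq [NullSingletonClass ν] {a : ℝ} (ha : 0 < a) (z : ℂ) :
    (fun t : ℝ => Real.log ‖z - (a * t : ℝ)‖) =ᵐ[ν]
      fun t : ℝ => Real.log a + Real.log ‖z / a - t‖ := by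
  filter_upwards [compl_mem_ae_iff.2 (measure_singleton (μ := ν) (z / a).re)] with t ht
  have h1 : z - (a * t : ℝ) = a * (z / a - t) := by
    have : (a : ℂ) ≠ 0 := by exact_mod_cast ha.ne'
    push_cast
    field_simp
  have h2 : z / a - t ≠ 0 := by
    intro h0
    refine ht ?_
    rw [sub_eq_zero.1 h0]
    simp
  rw [h1, norm_mul, Complex.norm_real, Real.norm_of_nonneg ha.le,
    Real.log_mul ha.ne' (norm_ne_zero_iff.2 h2)]

theorem HasContinuousPotential.linePotential_smul_map (h : HasContinuousPotential ν R) {a : ℝ}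
    (ha : 0 < a) (hs : 0 < s) (z : ℂ) :
    linePotential (ENNReal.ofReal s • ν.map (a * ·)) z =
      s * (linePotential ν (z / a) - ν.real Set.univ * Real.log a) := by
  have := h.finite
  have := h.noAtoms
  have hm : AEStronglyMeasurable (fun t : ℝ => -Real.log ‖z - t‖) (ν.map (a * ·)) :=
    (measurable_log_norm_sub.comp
      (measurable_const.prodMk measurable_id)).neg.aestronglyMeasurable
  rw [linePotential, integral_smul_measure, ENNReal.toReal_ofReal hs.le, smul_eq_mul,
    integral_map (measurable_const_mul a).aemeasurable hm, integral_neg,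
    integral_congr_ae (log_norm_sub_mul_ae_eq ha z),
    integral_add (integrable_const _) (h.integrable _), integral_const, smul_eq_mul,
    linePotential, integral_neg]
  ring

theorem HasContinuousPotential.smul_map (h : HasContinuousPotential ν R) {a : ℝ} (ha : 0 < a)
    (hs : 0 < s) : HasContinuousPotential (ENNReal.ofReal s • ν.map (a * ·)) (a * R) := by
  have := h.finite
  have := h.noAtoms
  have hma : Measurable (a * · : ℝ → ℝ) := measurable_const_mul a
  refine ⟨Measure.smul_finite _ ENNReal.ofReal_ne_top, ⟨fun x => ?_⟩, mul_pos ha h.radius_pos,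
    ?_, fun z => ?_, ?_⟩
  · rw [Measure.smul_apply, Measure.map_apply hma (measurableSet_singleton x)]
    have : (a * · : ℝ → ℝ) ⁻¹' {x} = {x / a} := by
      ext t
      simp only [Set.mem_preimage, Set.mem_singleton_iff]
      rw [eq_div_iff ha.ne', mul_comm]
    rw [this, measure_singleton, smul_zero]
  · refine Measure.ae_smul_measure ?_ _
    rw [ae_map_iff hma.aemeasurable (measurableSet_le (by fun_prop) measurable_const)]
    filter_upwards [h.ae_abs_le] with t ht
    rw [abs_mul, abs_of_pos ha]
    exact mul_le_mul_of_nonneg_left ht ha.le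
  · refine Integrable.smul_measure ?_ ENNReal.ofReal_ne_top
    have hm : Measurable fun t : ℝ => Real.log ‖z - t‖ :=
      measurable_log_norm_sub.comp (measurable_const.prodMk measurable_id)
    rw [integrable_map_measure hm.aestronglyMeasurable hma.aemeasurable]
    exact ((integrable_const _).add (h.integrable _)).congr (log_norm_sub_mul_ae_eq ha z).symm
  · rw [funext (h.linePotential_smul_map ha hs)]
    exact continuous_const.mul ((h.continuous.comp (continuous_id.div_const _)).sub
      continuous_const)

/-- Dilating by `s ^ γ` and multiplying by `s` turns an equilibrium pair of mass `1` for the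
rescaled potential into one of mass `s` for `V`. -/
theorem IsEquilibriumPair.of_rescaledPotential {γ C : ℝ} (hV : Continuous V) (hs : 0 < s)
    (h : IsEquilibriumPair (rescaledPotential V γ s) 1 ν C) :
    IsEquilibriumPair V s (ENNReal.ofReal s • ν.map (s ^ γ * ·)) (s * C - γ * s * Real.log s) := by
  obtain ⟨R, hR⟩ := h.hasContinuousPotential
  have ha : 0 < s ^ γ := Real.rpow_pos_of_pos hs γ
  have hma : Measurable (s ^ γ * · : ℝ → ℝ) := measurable_const_mul _
  have hP : ∀ x : ℝ, linePotential (ENNReal.ofReal s • ν.map (s ^ γ * ·)) ((s ^ γ * x : ℝ) : ℂ) =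
      s * (linePotential ν x - γ * Real.log s) := by
    intro x
    have hne : ((s ^ γ : ℝ) : ℂ) ≠ 0 := by exact_mod_cast ha.ne'
    rw [hR.linePotential_smul_map ha hs, h.real_mass one_pos, Real.log_rpow hs, one_mul,
      Complex.ofReal_mul, mul_div_cancel_left₀ _ hne]
  have hres : ∀ x, s * rescaledPotential V γ s x = V (s ^ γ * x) := fun x =>
    mul_div_cancel₀ _ hs.ne'
  refine ⟨?_, ⟨_, hR.smul_map ha hs⟩, fun x => ?_, ?_⟩
  · rw [Measure.smul_apply, Measure.map_apply hma .univ, Set.preimage_univ, h.mass]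
    simp
  · obtain ⟨y, rfl⟩ : ∃ y, x = s ^ γ * y := ⟨x / s ^ γ, (mul_div_cancel₀ _ ha.ne').symm⟩
    have h1 := mul_le_mul_of_nonneg_left (h.ge y) hs.le
    rw [hP]
    linarith [hres y]
  · have hc := (hR.smul_map ha hs).continuous.comp Complex.continuous_ofReal
    refine Measure.ae_smul_measure ?_ _
    have hcl : IsClosed {x : ℝ | linePotential (ENNReal.ofReal s • ν.map (s ^ γ * ·)) x =
        s * C - γ * s * Real.log s - V x} := isClosed_eq hc (continuous_const.sub hV)
    rw [ae_map_iff hma.aemeasurable hcl.measurableSet]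
    filter_upwards [h.ae_eq] with t ht
    rw [hP, ht]
    linarith [hres t]

/-! ### The potentials in the plane -/

/-- The identification of the Euclidean plane with `ℂ`. -/
noncomputable def planeToComplex (x : EuclideanSpace ℝ (Fin 2)) : ℂ := ⟨x 0, x 1⟩

theorem norm_planeToComplex (x : EuclideanSpace ℝ (Fin 2)) : ‖planeToComplex x‖ = ‖x‖ := by
  rw [EuclideanSpace.norm_eq, Fin.sum_univ_two, Complex.norm_eq_sqrt_sq_add_sq]
  simp [planeToComplex]

theorem edist_line (x : EuclideanSpace ℝ (Fin 2)) (t : ℝ) :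
    edist x (!₂[t, 0] : EuclideanSpace ℝ (Fin 2)) = ENNReal.ofReal ‖planeToComplex x - t‖ := by
  have h : planeToComplex x - t = planeToComplex (x - !₂[t, 0]) := by
    apply Complex.ext <;> simp [planeToComplex]
  rw [edist_dist, dist_eq_norm, h, norm_planeToComplex]

theorem planeToComplex_line (t : ℝ) :
    planeToComplex (!₂[t, 0] : EuclideanSpace ℝ (Fin 2)) = t := by
  apply Complex.ext <;> simp [planeToComplex]

theorem eintegral_eq_integral {X : Type*} [MeasurableSpace X] {μ : Measure X} {f : X → EReal}
    {g : X → ℝ} (hfg : ∀ᵐ x ∂μ, f x = g x) (hg : Integrable g μ) :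
    eintegral μ f = ((∫ x, g x ∂μ : ℝ) : EReal) := by
  have h1 : ∫⁻ x, (f x).toENNReal ∂μ = ∫⁻ x, ENNReal.ofReal (g x) ∂μ :=
    lintegral_congr_ae (hfg.mono fun x hx => by simp only [hx, EReal.real_coe_toENNReal])
  have h2 : ∫⁻ x, (-(f x)).toENNReal ∂μ = ∫⁻ x, ENNReal.ofReal (-g x) ∂μ :=
    lintegral_congr_ae (hfg.mono fun x hx => by
      simp only [hx, ← EReal.coe_neg, EReal.real_coe_toENNReal])
  have h3 : ∫⁻ x, ENNReal.ofReal (g x) ∂μ ≠ ⊤ := hg.lintegral_lt_top.ne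
  have h4 : ∫⁻ x, ENNReal.ofReal (-g x) ∂μ ≠ ⊤ := hg.neg.lintegral_lt_top.ne
  rw [eintegral, h1, h2, integral_eq_lintegral_pos_part_sub_lintegral_neg_part hg, EReal.coe_sub,
    EReal.coe_ennreal_toReal h3, EReal.coe_ennreal_toReal h4]

theorem HasContinuousPotential.logPotential_eq (h : HasContinuousPotential μ R)
    (x : EuclideanSpace ℝ (Fin 2)) :
    logPotential μ x = (linePotential μ (planeToComplex x) : EReal) := by
  have := h.noAtoms
  refine eintegral_eq_integral ?_ (h.integrable _).neg
  filter_upwards [compl_mem_ae_iff.2 (measure_singleton (μ := μ) (planeToComplex x).re)] with t ht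
  have h0 : planeToComplex x - t ≠ 0 := by
    intro h0
    refine ht ?_
    rw [sub_eq_zero.1 h0]
    simp
  rw [edist_line, ENNReal.log_ofReal_of_pos (norm_pos_iff.2 h0), ← EReal.coe_neg]

theorem IsEquilibriumPair.equilibriumConstant_eq {C : ℝ}
    (h : IsEquilibriumPair V 1 (equilibriumMeasure V 1) C) : equilibriumConstant V = C := by
  obtain ⟨R, hR⟩ := h.hasContinuousPotential
  have hP : ∀ x : ℝ, logPotential (equilibriumMeasure V 1) !₂[x, 0] =
      (linePotential (equilibriumMeasure V 1) x : EReal) := fun x => by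
    rw [hR.logPotential_eq, planeToComplex_line]
  have hC : IsEulerLagrangeConstant V (equilibriumMeasure V 1) C := by
    refine ⟨fun x => ?_, ?_⟩
    · rw [hP]
      exact EReal.coe_le_coe_iff.2 (h.ge x)
    · filter_upwards [h.ae_eq] with x hx
      rw [hP, hx]
  have hspec : IsEulerLagrangeConstant V (equilibriumMeasure V 1) (equilibriumConstant V) :=
    Classical.epsilon_spec (p := fun C : ℝ => IsEulerLagrangeConstant V (equilibriumMeasure V 1) C)
      ⟨C, hC⟩
  have hne : (ae (equilibriumMeasure V 1)).NeBot := by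
    rw [ae_neBot]
    intro h0
    have := h.mass
    rw [h0] at this
    simp at this
  obtain ⟨x, hx₁, hx₂⟩ := (hspec.2.and hC.2).exists
  have h1 := EReal.coe_injective (hx₁.symm.trans hx₂)
  linarith

theorem exists_isEquilibriumPair_equilibriumMeasure (hV : Continuous V)
    (hVs : IsSuperlogarithmic V) (hs : 0 < s) :
    ∃ F, IsEquilibriumPair V s (equilibriumMeasure V s) F :=
  IsEnergyMinimizer.exists_isEquilibriumPair hV hVs hs
    (Classical.epsilon_spec (exists_isEnergyMinimizer hV hVs hs))

/-- The additive constant in the shifted potential is the one of the Euler–Lagrange conditions for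
the measure of mass `s`, by rescaling and uniqueness of that constant. -/
theorem shiftedPotential_eq (hV : Continuous V) (hVs : IsSuperlogarithmic V) (γ : ℝ)
    (hs : 0 < s) {F : ℝ} (h : IsEquilibriumPair V s (equilibriumMeasure V s) F)
    (x : EuclideanSpace ℝ (Fin 2)) : shiftedPotential V γ s x =
      ((linePotential (equilibriumMeasure V s) (planeToComplex x) - F : ℝ) : EReal) := by
  obtain ⟨R, hR⟩ := h.hasContinuousPotential
  have hVc : Continuous (rescaledPotential V γ s) :=
    (hV.comp (continuous_const.mul continuous_id)).div_const s
  obtain ⟨C, hC⟩ := exists_isEquilibriumPair_equilibriumMeasure hVc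
    (hVs.rescaledPotential γ hs) one_pos
  have hF := h.constant_unique hV (hC.of_rescaledPotential hV hs) hs
  rw [shiftedPotential, hR.logPotential_eq, hC.equilibriumConstant_eq, ← EReal.coe_add, hF]
  congr 1
  ring

/-- The contact set of an equilibrium pair is bounded, since `V` grows faster than the
potential decays. -/
theorem IsEquilibriumPair.exists_abs_le {F : ℝ} (h : IsEquilibriumPair V s μ F)
    (hVs : IsSuperlogarithmic V) (hs : 0 < s) :
    ∃ R > 0, ∀ x : ℝ, linePotential μ x = F - V x → |x| ≤ R := by
  obtain ⟨R, hR⟩ := h.hasContinuousPotential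
  obtain ⟨B, hB⟩ := hVs (s + 1)
  refine ⟨max (2 * R) (Real.exp (F + s * Real.log 2 + B)), lt_max_of_lt_right (Real.exp_pos _),
    fun x hx => ?_⟩
  rcases le_total |x| (2 * R) with hxR | hxR
  · exact hxR.trans (le_max_left _ _)
  · refine le_trans ?_ (le_max_right _ _)
    have hx0 : 0 < |x| := by linarith [hR.radius_pos]
    have h1 := (abs_le.1 (hR.abs_add_log_le (z := (x : ℂ))
      (by rwa [Complex.norm_real, Real.norm_eq_abs]))).1
    rw [h.real_mass hs, Complex.norm_real, Real.norm_eq_abs, hx] at h1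
    have h2 : Real.log |x| ≤ Real.log (1 + |x|) := Real.log_le_log hx0 (by linarith)
    have h3 := mul_le_mul_of_nonneg_left h2 hs.le
    rw [← Real.log_le_iff_le_exp hx0]
    linarith [hB x]

end

end LogGas

theorem mainTheorem8 (V : ℝ → ℝ) (hV : Continuous V)
    (hgrowth : Tendsto (fun x : ℝ => V x / Real.log |x|) (cocompact ℝ) atTop) (γ : ℝ) :
    (∀ s : ℝ, 0 < s → ∀ x : EuclideanSpace ℝ (Fin 2),
      LogGas.shiftedPotential V γ s x ≠ ⊥ ∧ LogGas.shiftedPotential V γ s x ≠ ⊤) ∧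
    (∀ s s' : ℝ, 0 < s → s < s' → ∀ x : EuclideanSpace ℝ (Fin 2),
      LogGas.shiftedPotential V γ s' x ≤ LogGas.shiftedPotential V γ s x) ∧
    (∀ M : ℝ, 0 < M → ∃ R₀ : ℝ, 0 < R₀ ∧ ∀ R : ℝ, R₀ ≤ R → ∃ a : ℝ, 0 < a ∧
      ∀ s δ : ℝ, 0 < δ → 0 < s - δ → s ≤ M →
        ∀ x : EuclideanSpace ℝ (Fin 2), x ∈ Metric.sphere 0 R → R / 2 < |x 1| →
          ((a * δ : ℝ) : EReal) <
            LogGas.shiftedPotential V γ (s - δ) x - LogGas.shiftedPotential V γ s x) := by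
  have hVs := LogGas.isSuperlogarithmic_of_tendsto hV hgrowth
  have hex := fun s (hs : 0 < s) =>
    LogGas.exists_isEquilibriumPair_equilibriumMeasure hV hVs hs
  refine ⟨fun s hs x => ?_, fun s s' hs hss' x => ?_, fun M hM => ?_⟩
  · obtain ⟨F, hF⟩ := hex s hs
    rw [LogGas.shiftedPotential_eq hV hVs γ hs hF]
    exact ⟨EReal.coe_ne_bot _, EReal.coe_ne_top _⟩
  · obtain ⟨F, hF⟩ := hex s hs
    obtain ⟨F', hF'⟩ := hex s' (hs.trans hss')
    rw [LogGas.shiftedPotential_eq hV hVs γ hs hF,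
      LogGas.shiftedPotential_eq hV hVs γ (hs.trans hss') hF']
    exact EReal.coe_le_coe_iff.2 (hF.sub_le_sub hV hF' hs hss'.le _)
  · obtain ⟨FM, hFM⟩ := hex M hM
    obtain ⟨R₁, hR₁, hcontact⟩ := hFM.exists_abs_le hVs hM
    refine ⟨2 * R₁, by linarith, fun R hR => ?_⟩
    have hR0 : 0 < R := by linarith
    have hlog : 0 < Real.log R - Real.log R₁ :=
      sub_pos.2 (Real.log_lt_log hR₁ (by linarith))
    refine ⟨(Real.log R - Real.log R₁) / 4, by linarith, ?_⟩
    intro s δ hδ hsδ hsM x hx _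
    have hs : 0 < s := by linarith
    obtain ⟨F, hF⟩ := hex s hs
    obtain ⟨F', hF'⟩ := hex (s - δ) hsδ
    obtain ⟨r, hr⟩ := hF.hasContinuousPotential
    obtain ⟨r', hr'⟩ := hF'.hasContinuousPotential
    -- The contact sets increase with the mass, so all measures of mass at most `M` live on the
    -- contact set of mass `M`.
    have hsupp : ∀ᵐ t ∂LogGas.equilibriumMeasure V s, |t| ≤ R₁ := by
      filter_upwards [hF.ae_eq] with t ht
      refine hcontact t (le_antisymm ?_ (hFM.ge t))
      linarith [hF.sub_le_sub hV hFM hs hsM t]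
    have hxn : ‖LogGas.planeToComplex x‖ = R := by
      rw [LogGas.norm_planeToComplex]
      simpa using hx
    have key := hr'.mul_log_le_sub (hr.of_ae_abs_le hR₁ hsupp) (δ := δ) (k := F - F') hδ
      (by rw [hF.real_mass hs, hF'.real_mass hsδ]; ring)
      (fun z => by linarith [hF'.sub_le_sub hV hF hsδ (by linarith) z])
      (z := LogGas.planeToComplex x) (by linarith)
    rw [hxn] at key
    rw [LogGas.shiftedPotential_eq hV hVs γ hs hF, LogGas.shiftedPotential_eq hV hVs γ hsδ hF',
      ← EReal.coe_sub, EReal.coe_lt_coe_iff]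
    have := mul_pos hlog hδ
    linarith
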